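/- Let $K$ be a field, $c\ge 1$ and $i\ge 0$ integers, and put $R=K[x_{k,j}\mid 1\le k\le c,\ j\ge 1]$ and $R_n=K[x_{k,j}\mid 1\le k\le c,\ 1\le j\le n]$ for $n\ge1$. Let $\mathrm{Inc}(\mathbb N)^i$ be the monoid of strictly increasing maps $\pi:\{1,2,\dots\}\to\{1,2,\dots\}$ with $\pi(j)=j$ for all $j\le i$, acting on $R$ by $\pi(x_{k,j})=x_{k,\pi(j)}$. Let $\mathcal I=(I_n)_{n\ge1}$ be a sequence of graded ideals $I_n\subseteq R_n$, not all zero, that is $\mathrm{Inc}(\mathbb N)^i$-invariant, i.e. $\pi(I_m)\subseteq I_n$ whenever $m\le n$, $\pi\in \mathrm{Inc}(\mathbb N)^i$ and $\pi(m)\le n$. Let $\le$ be a monomial order on $R$ (a total order on the monomials, compatible with multiplication, with least element $1$) that respects $\mathrm{Inc}(\mathbb N)^i$, i.e. $u\le v$ implies $\pi(u)\le\pi(v)$ for all monomials $u,v$ and all $\pi\in\mathrm{Inc}(\mathbb N)^i$. Denote by $\mathrm{in}_\le(\mathcal I)=(\mathrm{in}_\le(I_n))_{n\ge1}$ the sequence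 of initial ideals. For a nonzero monomial ideal $J\subseteq R_n$ let $G(J)$ be its minimal set of monomial generators, and for $p\ge0$ let $G^{(p)}_+(J)$ be the set of those $u\in G(J)$ with $u\neq1$ that are divisible by no variable $x_{k,j}$ with $j\le p$. For a monomial $u\in R_n$ let $w^{(p)}_k(u)$ be the largest exponent in $u$ of a variable $x_{k,j}$ with $p<j\le n$ (and $0$ if there is none), and $w^{(p)}(u)=\max_k w_k^{(p)}(u)$. Put $w_k^{(p)}(J)=\max\{w_k^{(p)}(u)\mid u\in G(J)\}$, and let $\omega^{(p)}(J)$ be $\min\{w^{(p)}(u)\mid u\in G_+^{(p)}(J)\}$ if $G_+^{(p)}(J)\neq\emptyset$ and $\max\{w^{(p)}(u)\mid u\in G(J)\}$ otherwise. Then there are integers $\omega,w_1,\dots,w_c\ge0$ such that for all sufficiently large $p$ and all sufficiently large $n$ (depending on $p$) one has $\omega^{(p)}(\mathrm{in}_\le(I_n))=\omega$ and $w_k^{(p)}(\mathrm{in}_\le(I_n))=w_k$ for $1\le k\le c$; and, with $$C(\mathrm{in}_\le(\mathcal I))=\max\{\omega-1,0\}+\max\Big\{\sum_{k\neq l}w_k\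 \Big|\ 1\le l\le c\Big\},$$ there is a constant $D\in\mathbb Z$ such that $$\mathrm{reg}(I_n)\le C(\mathrm{in}_\le(\mathcal I))\,n+D\qquad\text{for all } n\gg0,$$ where $\mathrm{reg}(I_n)=\max\{q-p\mid \mathrm{Tor}_p^{R_n}(K,I_n)_q\neq0\}$ is the Castelnuovo-Mumford regularity. -/

import Mathlib

open Filter MvPolynomial

noncomputable section

/-! ### Koszul complex, graded Tor and regularity of an ideal of a polynomial ring -/

section Regularity

variable {K σ : Type*} [Field K] [Fintype σ] [LinearOrder σ]

/-- The Koszul differential of `S = K[σ]`. A chain `∑ f A • e_A` (with `e_A` the wedge of the basis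
vectors in `A`, in increasing order) is stored as the function `A ↦ f A`, and
`e_A ↦ ∑_{v ∈ A} (-1)^{#{a ∈ A | a < v}} x_v e_{A \ v}`. -/
def koszulD : (Finset σ → MvPolynomial σ K) →ₗ[K] (Finset σ → MvPolynomial σ K) where
  toFun f B := ∑ v ∈ Finset.univ \ B,
    (-1) ^ (B.filter (· < v)).card * (X v * f (insert v B))
  map_add' f g := by
    funext B
    simp only [Pi.add_apply, mul_add, Finset.sum_add_distrib]
  map_smul' r f := by
    funext B
    simp only [Pi.smul_apply, RingHom.id_apply, Finset.smul_sum, mul_smul_comm]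

/-- The Koszul differential squares to zero. -/
theorem koszulD_comp (f : Finset σ → MvPolynomial σ K) : koszulD (koszulD f) = 0 := by
  funext B
  simp only [koszulD, LinearMap.coe_mk, AddHom.coe_mk, Pi.zero_apply, Finset.mul_sum]
  rw [Finset.sum_sigma']
  refine Finset.sum_involution (fun x _ => ⟨x.2, x.1⟩) ?_ ?_ ?_ ?_
  · rintro ⟨v, w⟩ h
    simp only [Finset.mem_sigma, Finset.mem_sdiff, Finset.mem_univ, true_and, Finset.mem_insert, not_or] at h
    obtain ⟨hv, hwv, hw⟩ := h
    simp only [Finset.insert_comm w v B, Finset.filter_insert]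
    rcases lt_or_gt_of_ne hwv with h | h
    · rw [if_neg h.not_gt, if_pos h, Finset.card_insert_of_notMem (by simp [hw])]
      ring
    · rw [if_pos h, if_neg h.not_gt, Finset.card_insert_of_notMem (by simp [hv])]
      ring
  · rintro ⟨v, w⟩ h _ heq
    simp only [Finset.mem_sigma, Finset.mem_sdiff, Finset.mem_univ, true_and, Finset.mem_insert, not_or] at h
    simp only [Sigma.mk.injEq, heq_eq_eq] at heq
    exact h.2.1 heq.1
  · rintro ⟨v, w⟩ h
    simp only [Finset.mem_sigma, Finset.mem_sdiff, Finset.mem_univ, true_and, Finset.mem_insert, not_or] at h ⊢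
    exact ⟨h.2.2, fun e => h.2.1 e.symm, h.1⟩
  · rintro ⟨v, w⟩ h; rfl

/-- The part of internal degree `j` of the Koszul chains in homological degree `p` with
coefficients in the ideal `I`: `e_A` sits in homological and internal degree `#A`. -/
def koszulChains (I : Ideal (MvPolynomial σ K)) (p j : ℕ) :
    Submodule K (Finset σ → MvPolynomial σ K) where
  carrier := {f | ∀ A, f A ∈ I ∧ (f A ≠ 0 → A.card = p) ∧ ∀ s ∈ (f A).support, s.degree + p = j}
  zero_mem' A := by simp
  add_mem' {f g} hf hg A := by
    classical
    refine ⟨I.add_mem (hf A).1 (hg A).1, fun h => ?_, fun s hs => ?_⟩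
    · by_cases h0 : f A = 0
      · exact (hg A).2.1 fun h1 => h (by simp [h0, h1])
      · exact (hf A).2.1 h0
    · rcases Finset.mem_union.1 (support_add hs) with h | h
      · exact (hf A).2.2 s h
      · exact (hg A).2.2 s h
  smul_mem' r f hf A := by
    refine ⟨?_, fun h => ?_, fun s hs => ?_⟩
    · simpa [smul_eq_C_mul] using I.mul_mem_left (C r) (hf A).1
    · exact (hf A).2.1 fun h1 => h (by simp [h1])
    · exact (hf A).2.2 s (support_smul hs)

/-- Koszul cycles of homological degree `p` and internal degree `j`. -/
def koszulCycles (I : Ideal (MvPolynomial σ K)) (p j : ℕ) :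
    Submodule K (Finset σ → MvPolynomial σ K) :=
  koszulChains I p j ⊓ LinearMap.ker koszulD

/-- Koszul boundaries of homological degree `p` and internal degree `j`. -/
def koszulBoundaries (I : Ideal (MvPolynomial σ K)) (p j : ℕ) :
    Submodule K (Finset σ → MvPolynomial σ K) :=
  (koszulChains I (p + 1) j).map koszulD

/-- `Tor_p^S(K, I)_j` for `S = K[σ]`, computed from the Koszul complex, which is the minimal graded
free resolution of `K` over `S`: the homology of (Koszul complex) `⊗_S I`. -/
abbrev gradedTor (I : Ideal (MvPolynomial σ K)) (p j : ℕ) : Type _ :=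
  koszulCycles I p j ⧸ (koszulBoundaries I p j).submoduleOf (koszulCycles I p j)

/-- Castelnuovo-Mumford regularity: the supremum of all `j - p` with `Tor_p^S(K, I)_j ≠ 0`
(so `⊥` for the zero ideal). -/
def regularity (I : Ideal (MvPolynomial σ K)) : EReal :=
  sSup {x | ∃ p j : ℕ, Nontrivial (gradedTor I p j) ∧ x = (((j : ℝ) - (p : ℝ) : ℝ) : EReal)}

/-- Graded ideals: closed under taking homogeneous components. -/
def IsGradedIdeal {τ : Type*} (J : Ideal (MvPolynomial τ K)) : Prop :=
  ∀ f ∈ J, ∀ d : ℕ, homogeneousComponent d f ∈ J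

end Regularity

/-! ### The rings `R_n ⊆ R` and the monoids `Inc(ℕ)^i`

The second index of a variable runs over `0, 1, 2, …` instead of `1, 2, 3, …`. -/

/-- Index set of the variables of `R_n`. -/
abbrev FinVar (c n : ℕ) : Type := Fin c ×ₗ Fin n

/-- Index set of the variables of `R`. -/
abbrev InfVar (c : ℕ) : Type := Fin c × ℕ

/-- The inclusion of the variables of `R_n` into those of `R`. -/
def varIncl (c n : ℕ) (v : FinVar c n) : InfVar c := ((ofLex v).1, ((ofLex v).2 : ℕ))

/-- The inclusion `R_n ⊆ R`. -/
def ringIncl (K : Type*) [Field K] (c n : ℕ) :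
    MvPolynomial (FinVar c n) K →ₐ[K] MvPolynomial (InfVar c) K :=
  rename (varIncl c n)

/-- `Inc(ℕ)^i`: strictly increasing maps that fix the first `i` indices. -/
def IncMonoid (i : ℕ) : Set (ℕ → ℕ) := {π | StrictMono π ∧ ∀ j < i, π j = j}

/-- The action of a map of indices on variables. -/
def varAct (c : ℕ) (π : ℕ → ℕ) (v : InfVar c) : InfVar c := (v.1, π v.2)

/-- `Inc(ℕ)^i`-invariance of a sequence of ideals `I n ⊆ R_n`, `n ≥ 1` (`I 0` plays no role):
`π(I_m) ⊆ I_n` whenever `π` maps the first `m` indices into the first `n` indices. -/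
def IsIncInvariant {K : Type*} [Field K] {c : ℕ} (i : ℕ)
    (I : (n : ℕ) → Ideal (MvPolynomial (FinVar c n) K)) : Prop :=
  ∀ m n : ℕ, 1 ≤ m → m ≤ n → ∀ π ∈ IncMonoid i, (∀ j < m, π j < n) →
    ∀ f ∈ I m, ∃ g ∈ I n, ringIncl K c n g = rename (varAct c π) (ringIncl K c m f)

/-! ### Monomial orders and initial ideals -/

/-- Monomial orders (on exponent vectors): total, multiplicative, with `1` as least element.
A well-order on all monomials is not required when there are infinitely many variables. -/
structure IsMonomialOrder {τ : Type*} (le : (τ →₀ ℕ) → (τ →₀ ℕ) → Prop) : Prop where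
  total : ∀ u v, le u v ∨ le v u
  antisymm : ∀ u v, le u v → le v u → u = v
  trans : ∀ u v w, le u v → le v w → le u w
  zero_le : ∀ u, le 0 u
  add_le_add : ∀ u v w, le u v → le (u + w) (v + w)

/-- The order respects `Inc(ℕ)^i`. -/
def RespectsInc {c : ℕ} (i : ℕ) (le : (InfVar c →₀ ℕ) → (InfVar c →₀ ℕ) → Prop) : Prop :=
  ∀ π ∈ IncMonoid i, ∀ u v : InfVar c →₀ ℕ, le u v →
    le (u.mapDomain (varAct c π)) (v.mapDomain (varAct c π))

/-- Restriction to the monomials of `R_n` of an order on the monomials of `R`. -/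
def restrictOrder {c : ℕ} (le : (InfVar c →₀ ℕ) → (InfVar c →₀ ℕ) → Prop) (n : ℕ)
    (u v : FinVar c n →₀ ℕ) : Prop :=
  le (u.mapDomain (varIncl c n)) (v.mapDomain (varIncl c n))

/-- The initial ideal: generated by the leading monomials of the nonzero elements of `J`. -/
def initialIdeal {K τ : Type*} [Field K] (le : (τ →₀ ℕ) → (τ →₀ ℕ) → Prop)
    (J : Ideal (MvPolynomial τ K)) : Ideal (MvPolynomial τ K) :=
  Ideal.span {x | ∃ f ∈ J, ∃ s ∈ f.support, (∀ t ∈ f.support, le t s) ∧ x = monomial s 1}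

/-- The chain of initial ideals. -/
def initialChain {K : Type*} [Field K] {c : ℕ}
    (le : (InfVar c →₀ ℕ) → (InfVar c →₀ ℕ) → Prop)
    (I : (n : ℕ) → Ideal (MvPolynomial (FinVar c n) K)) :
    (n : ℕ) → Ideal (MvPolynomial (FinVar c n) K) :=
  fun n => initialIdeal (restrictOrder le n) (I n)

/-! ### Weights -/

section Weights

variable {K : Type*} [Field K] {c : ℕ}

/-- Exponents of the minimal monomial generators of a monomial ideal. -/
def minGens {τ : Type*} (J : Ideal (MvPolynomial τ K)) : Set (τ →₀ ℕ) :=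
  {u | monomial u (1 : K) ∈ J ∧ ∀ v : τ →₀ ℕ, monomial v (1 : K) ∈ J → v ≤ u → v = u}

/-- Minimal generators `u ≠ 1` that involve none of the first `i` column indices. -/
def minGensPlus {n : ℕ} (i : ℕ) (J : Ideal (MvPolynomial (FinVar c n) K)) :
    Set (FinVar c n →₀ ℕ) :=
  {u | u ∈ minGens J ∧ u ≠ 0 ∧ ∀ v ∈ u.support, i ≤ ((ofLex v).2 : ℕ)}

/-- `w_k^{(i)}(u)`: the largest exponent in `u` of a variable of row `k` outside the first `i`
columns. -/
def rowWeight {n : ℕ} (i : ℕ) (k : Fin c) (u : FinVar c n →₀ ℕ) : ℕ :=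
  (Finset.univ.filter fun j : Fin n => i ≤ (j : ℕ)).sup fun j => u (toLex (k, j))

/-- `w^{(i)}(u)`. -/
def weight {n : ℕ} (i : ℕ) (u : FinVar c n →₀ ℕ) : ℕ :=
  Finset.univ.sup fun k : Fin c => rowWeight i k u

/-- `w_k^{(i)}(J)`. -/
def idealRowWeight {n : ℕ} (i : ℕ) (k : Fin c) (J : Ideal (MvPolynomial (FinVar c n) K)) : ℕ :=
  sSup (rowWeight i k '' minGens J)

open Classical in
/-- `ω^{(i)}(J)`. -/
def idealOmega {n : ℕ} (i : ℕ) (J : Ideal (MvPolynomial (FinVar c n) K)) : ℕ :=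
  if (minGensPlus i J).Nonempty then sInf (weight i '' minGensPlus i J)
  else sSup (weight i '' minGens J)

/-- The eventual value of an eventually constant sequence. -/
def eventualValue (a : ℕ → ℕ) : ℕ := sInf {v | ∀ᶠ n in atTop, a n = v}

/-- `w_k(𝓘)`: the value for `i ≫ 0` of the value for `n ≫ 0` of `w_k^{(i)}(I_n)`. -/
def chainRowWeight (I : (n : ℕ) → Ideal (MvPolynomial (FinVar c n) K)) (k : Fin c) : ℕ :=
  eventualValue fun i => eventualValue fun n => idealRowWeight i k (I n)

/-- `ω(𝓘)`: the value for `i ≫ 0` of the value for `n ≫ 0` of `ω^{(i)}(I_n)`. -/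
def chainOmega (I : (n : ℕ) → Ideal (MvPolynomial (FinVar c n) K)) : ℕ :=
  eventualValue fun i => eventualValue fun n => idealOmega i (I n)

/-- `C(𝓘) = max{ω(𝓘) - 1, 0} + max_l ∑_{k ≠ l} w_k(𝓘)` (subtraction in `ℕ` is truncated). -/
def chainC (I : (n : ℕ) → Ideal (MvPolynomial (FinVar c n) K)) : ℕ :=
  (chainOmega I - 1) +
    Finset.univ.sup fun l : Fin c => ∑ k ∈ Finset.univ.erase l, chainRowWeight I k

end Weights

end

/-! The aim is a constant `D` with `Tor_p(K, I_n)_q = 0` whenever `q > C n + D + p` and `n` is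
large. Take a Koszul cycle and its largest multidegree `m` for the monomial order. Its coefficients
there form a simplicial cycle, and every monomial `x^(m - A)` that occurs is leading, hence lies in
the initial ideal. Suppose a variable `v₀` dividing `x^m` can be divided out of these monomials, for
`A` not containing `v₀`, without leaving the initial ideal. Then the cone with apex `v₀` bounds the
simplicial cycle. Lifting the cone to `I_n` and subtracting its boundary removes `m` and leaves only
smaller multidegrees. Finitely many multidegrees have total degree `q`, so the cycle is a boundary
(`koszulCycles_le_koszulBoundaries`). This treats `I_n` directly, with no separate comparison of its
regularity with that of the initial ideal.

It remains to find an apex in every multidegree of large degree. A variable whose exponent in `m`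
exceeds its exponent in all minimal generators is an apex. Otherwise column `j ≥ P` of `m` is
bounded entrywise by `(w_k)`. If many columns are large, a fixed monomial of the chain can be moved
by `Inc(ℕ)^i` into those that remain untouched after removing `A` and `v₀`, which again gives an
apex. If few are large, almost every column has sum at most `C`, so the degree of `m` is at most `C
n + D + p`; see `exists_eventually_hasConeApex_of_mem` and `exists_eventually_hasConeApex_of_sup`.

The weights stabilise by Higman's lemma (`IsIncClosed.exists_skip`): in large width every monomial
of the chain arises from the previous width by inserting a column, so exponent bounds on generators
persist. -/

noncomputable section

/-! ### Vanishing of Koszul homology by coning off leading multidegrees -/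

section KoszulVanishing

/-- The exponent vector of the squarefree monomial with support `A`. -/
def finsetExponent {σ : Type*} (A : Finset σ) : σ →₀ ℕ := ∑ a ∈ A, Finsupp.single a 1

theorem finsetExponent_apply {σ : Type*} [DecidableEq σ] (A : Finset σ) (x : σ) :
    finsetExponent A x = if x ∈ A then 1 else 0 := by
  simp [finsetExponent, Finsupp.finsetSum_apply, Finsupp.single_apply]

theorem finsetExponent_insert {σ : Type*} [DecidableEq σ] {A : Finset σ} {v : σ} (h : v ∉ A) :
    finsetExponent (insert v A) = Finsupp.single v 1 + finsetExponent A :=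
  Finset.sum_insert h

theorem degree_finsetExponent {σ : Type*} (A : Finset σ) :
    (finsetExponent A).degree = A.card := by
  simp [finsetExponent]

/-! ### Leading monomials and their lifts -/

section Order

variable {τ : Type*} {le : (τ →₀ ℕ) → (τ →₀ ℕ) → Prop}

theorem IsMonomialOrder.refl (h : IsMonomialOrder le) (u : τ →₀ ℕ) : le u u :=
  (h.total u u).elim id id

theorem IsMonomialOrder.le_of_add_le_add (h : IsMonomialOrder le) {u v w : τ →₀ ℕ}
    (huv : le (u + w) (v + w)) : le u v := by
  rcases h.total u v with h1 | h1
  · exact h1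
  · have := h.antisymm _ _ huv (h.add_le_add _ _ w h1)
    rw [add_right_cancel this]
    exact h.refl v

theorem IsMonomialOrder.exists_max (h : IsMonomialOrder le) (S : Finset (τ →₀ ℕ))
    (hS : S.Nonempty) : ∃ m ∈ S, ∀ u ∈ S, le u m := by
  classical
  induction hS using Finset.Nonempty.cons_induction with
  | singleton a => exact ⟨a, by simp, by simpa using h.refl a⟩
  | cons a s ha hs ih =>
    obtain ⟨m, hm, hmax⟩ := ih
    rcases h.total a m with h1 | h1
    · refine ⟨m, by simp [hm], fun u hu => ?_⟩
      rcases Finset.mem_cons.1 hu with rfl | hu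
      exacts [h1, hmax u hu]
    · refine ⟨a, by simp, fun u hu => ?_⟩
      rcases Finset.mem_cons.1 hu with rfl | hu
      exacts [h.refl _, h.trans _ _ _ (hmax u hu) h1]

variable {K : Type*} [Field K]

/-- Monomials of the initial ideal are leading monomials. -/
theorem monomial_mem_initialIdeal_iff (h : IsMonomialOrder le) (J : Ideal (MvPolynomial τ K))
    (u : τ →₀ ℕ) : monomial u (1 : K) ∈ initialIdeal le J ↔
      ∃ f ∈ J, u ∈ f.support ∧ ∀ t ∈ f.support, le t u := by
  classical
  constructor
  · intro hu
    have hset : {x | ∃ f ∈ J, ∃ s ∈ f.support, (∀ t ∈ f.support, le t s) ∧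
        x = monomial s (1 : K)} = (fun s => monomial s (1 : K)) ''
          {s | ∃ f ∈ J, s ∈ f.support ∧ ∀ t ∈ f.support, le t s} := by
      ext x
      constructor
      · rintro ⟨f, hf, s, hs, hmax, rfl⟩
        exact ⟨s, ⟨f, hf, hs, hmax⟩, rfl⟩
      · rintro ⟨s, ⟨f, hf, hs, hmax⟩, rfl⟩
        exact ⟨f, hf, s, hs, hmax, rfl⟩
    rw [initialIdeal, hset, mem_ideal_span_monomial_image] at hu
    obtain ⟨s, ⟨f, hf, hs, hmax⟩, hsu⟩ := hu u (by simp)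
    obtain ⟨d, rfl⟩ := exists_add_of_le hsu
    refine ⟨monomial d 1 * f, J.mul_mem_left _ hf, ?_, fun t ht => ?_⟩
    · rw [mem_support_iff, add_comm, coeff_monomial_mul, one_mul]
      exact mem_support_iff.1 hs
    · rw [mem_support_iff, coeff_monomial_mul'] at ht
      split_ifs at ht with hd
      · have := h.add_le_add _ _ d (hmax (t - d) (by rw [mem_support_iff]; simpa using ht))
        rwa [tsub_add_cancel_of_le hd] at this
      · exact absurd rfl ht
  · rintro ⟨f, hf, hu, hmax⟩
    exact Ideal.subset_span ⟨f, hf, u, hu, hmax, rfl⟩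

/-- Gradedness of the ideal enters here: the homogeneous component containing the leading monomial
stays in `J`, so corrections built from lifts keep the internal degree. -/
theorem exists_homogeneous_lift (h : IsMonomialOrder le) {J : Ideal (MvPolynomial τ K)}
    (hJ : IsGradedIdeal J) {u : τ →₀ ℕ} (hu : monomial u (1 : K) ∈ initialIdeal le J) :
    ∃ f ∈ J, coeff u f = 1 ∧ ∀ t ∈ f.support, le t u ∧ t.degree = u.degree := by
  obtain ⟨f, hf, huf, hmax⟩ := (monomial_mem_initialIdeal_iff h J u).1 hu
  rw [mem_support_iff] at huf
  refine ⟨C (coeff u f)⁻¹ * homogeneousComponent u.degree f,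
    J.mul_mem_left _ (hJ f hf _), ?_, fun t ht => ?_⟩
  · rw [coeff_C_mul, coeff_homogeneousComponent, if_pos rfl, inv_mul_cancel₀ huf]
  · rw [mem_support_iff, coeff_C_mul, coeff_homogeneousComponent] at ht
    split_ifs at ht with hd
    · exact ⟨hmax t (mem_support_iff.2 (right_ne_zero_of_mul ht)), hd⟩
    · simp at ht

end Order

/-- The coefficients of a Koszul chain in multidegree `m`. -/
def multidegreePart {K σ : Type*} [Field K] (m : σ →₀ ℕ)
    (f : Finset σ → MvPolynomial σ K) (A : Finset σ) : K :=
  if finsetExponent A ≤ m then coeff (m - finsetExponent A) (f A) else 0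

theorem multidegreePart_sub {K σ : Type*} [Field K] (m : σ →₀ ℕ)
    (f g : Finset σ → MvPolynomial σ K) (A : Finset σ) :
    multidegreePart m (f - g) A = multidegreePart m f A - multidegreePart m g A := by
  unfold multidegreePart
  split_ifs <;> simp

theorem multidegreePart_add_finsetExponent {K σ : Type*} [Field K] (u : σ →₀ ℕ)
    (f : Finset σ → MvPolynomial σ K) (A : Finset σ) :
    multidegreePart (u + finsetExponent A) f A = coeff u (f A) := by
  simp [multidegreePart]

/-- A variable dividing `x ^ m` that can be coned off the upper Koszul complex of the monomial
ideal `J` in multidegree `m` and homological degree `p`. -/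
def HasConeApex {K σ : Type*} [Field K] (J : Ideal (MvPolynomial σ K))
    (p : ℕ) (m : σ →₀ ℕ) : Prop :=
  ∃ v₀, 1 ≤ m v₀ ∧ ∀ A : Finset σ, A.card = p → v₀ ∉ A →
    ∀ u : σ →₀ ℕ, u + Finsupp.single v₀ 1 + finsetExponent A = m →
      monomial (u + Finsupp.single v₀ 1) (1 : K) ∈ J → monomial u (1 : K) ∈ J

/-! ### Simplicial cones and elimination of the leading multidegree -/

variable {K σ : Type*} [Field K] [Fintype σ] [LinearOrder σ]

/-- The simplicial boundary on functions on subsets of `σ`. -/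
def subsetBoundary (c : Finset σ → K) (B : Finset σ) : K :=
  ∑ v ∈ Finset.univ \ B, (-1) ^ (B.filter (· < v)).card * c (insert v B)

/-- The cone operator with apex `v₀`. -/
def coneOperator (v₀ : σ) (c : Finset σ → K) (B : Finset σ) : K :=
  if v₀ ∈ B then (-1) ^ ((B.erase v₀).filter (· < v₀)).card * c (B.erase v₀) else 0

/-- The cone operator is a contracting homotopy. -/
theorem subsetBoundary_coneOperator (v₀ : σ) (c : Finset σ → K)
    (hc : ∀ B, subsetBoundary c B = 0) (B : Finset σ) :
    subsetBoundary (coneOperator v₀ c) B = c B := by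
  have hsq : ∀ k : ℕ, ((-1 : K) ^ k) * (-1) ^ k = 1 := fun k => by
    rw [← mul_pow]; simp
  by_cases hB : v₀ ∈ B
  · obtain ⟨E, hE, rfl⟩ : ∃ E, v₀ ∉ E ∧ insert v₀ E = B :=
      ⟨B.erase v₀, by simp, Finset.insert_erase hB⟩
    -- The cycle condition at `E = B \ v₀` expresses `c B` through the values `c (insert v E)`,
    -- which are the terms of the boundary of the cone at `B`.
    have h0 := hc E
    have hs : (Finset.univ \ E : Finset σ) = insert v₀ (Finset.univ \ insert v₀ E) := by
      ext x
      by_cases hx : x = v₀ <;> simp [hx, hE]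
    rw [subsetBoundary, hs, Finset.sum_insert (by simp)] at h0
    have key : subsetBoundary (coneOperator v₀ c) (insert v₀ E) =
        -((-1) ^ (E.filter (· < v₀)).card * ∑ v ∈ Finset.univ \ insert v₀ E,
          (-1) ^ (E.filter (· < v)).card * c (insert v E)) := by
      rw [subsetBoundary, Finset.mul_sum, ← Finset.sum_neg_distrib]
      refine Finset.sum_congr rfl fun v hv => ?_
      simp only [Finset.mem_sdiff, Finset.mem_univ, true_and, Finset.mem_insert, not_or] at hv
      have he : (insert v (insert v₀ E)).erase v₀ = insert v E := by
        rw [Finset.insert_comm, Finset.erase_insert]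
        simp [hE, Ne.symm hv.1]
      rw [coneOperator, if_pos (by simp), he]
      simp only [Finset.filter_insert]
      rcases lt_or_gt_of_ne hv.1 with h | h
      · rw [if_neg h.not_gt, if_pos h, Finset.card_insert_of_notMem (by simp [hv.2])]
        ring
      · rw [if_pos h, if_neg h.not_gt, Finset.card_insert_of_notMem (by simp [hE])]
        ring
    rw [key, eq_neg_of_add_eq_zero_right h0]
    rw [mul_neg, neg_neg, ← mul_assoc, hsq, one_mul]
  · rw [subsetBoundary, Finset.sum_eq_single v₀]
    · rw [coneOperator, if_pos (by simp), Finset.erase_insert hB, ← mul_assoc, hsq, one_mul]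
    · intro v _ hv
      rw [coneOperator, if_neg (by simp [hB, Ne.symm hv]), mul_zero]
    · simp [hB]

/-- The Koszul differential is multigraded: multiplying by `x_v` compensates exactly for removing
`v` from the index set. -/
theorem multidegreePart_koszulD (m : σ →₀ ℕ) (f : Finset σ → MvPolynomial σ K) (B : Finset σ) :
    multidegreePart m (koszulD f) B = subsetBoundary (multidegreePart m f) B := by
  have hsgn : ∀ (k : ℕ) (u : σ →₀ ℕ) (P : MvPolynomial σ K),
      coeff u ((-1) ^ k * P) = (-1) ^ k * coeff u P := fun k u P => by
    rw [← coeff_C_mul]; simp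
  by_cases hB : finsetExponent B ≤ m
  · rw [multidegreePart, if_pos hB, subsetBoundary]
    simp only [koszulD, LinearMap.coe_mk, AddHom.coe_mk, coeff_sum, hsgn]
    refine Finset.sum_congr rfl fun v hv => ?_
    simp only [Finset.mem_sdiff, Finset.mem_univ, true_and] at hv
    congr 1
    rw [coeff_X_mul', multidegreePart, finsetExponent_insert hv]
    have hiff : v ∈ (m - finsetExponent B).support ↔
        Finsupp.single v 1 + finsetExponent B ≤ m := by
      rw [← le_tsub_iff_right hB, Finsupp.single_le_iff, Finsupp.mem_support_iff]
      omega
    rw [add_comm, ← tsub_tsub, add_comm]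
    simp only [hiff]
  · rw [multidegreePart, if_neg hB, subsetBoundary]
    refine (Finset.sum_eq_zero fun v hv => ?_).symm
    simp only [Finset.mem_sdiff, Finset.mem_univ, true_and] at hv
    rw [multidegreePart, finsetExponent_insert hv, if_neg, mul_zero]
    exact fun h => hB (le_trans le_add_self h)

theorem koszulD_mem_koszulChains {I : Ideal (MvPolynomial σ K)} {p j : ℕ}
    {g : Finset σ → MvPolynomial σ K} (hg : g ∈ koszulChains I (p + 1) j) :
    koszulD g ∈ koszulChains I p j := by
  intro B
  have hform : koszulD g B = ∑ v ∈ Finset.univ \ B,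
    (-1) ^ (B.filter (· < v)).card * (X v * g (insert v B)) := rfl
  refine ⟨?_, fun h => ?_, fun s hs => ?_⟩
  · rw [hform]
    exact I.sum_mem fun v _ => I.mul_mem_left _ (I.mul_mem_left _ (hg _).1)
  · rw [hform] at h
    obtain ⟨v, hv, hne⟩ := Finset.exists_ne_zero_of_sum_ne_zero h
    simp only [Finset.mem_sdiff, Finset.mem_univ, true_and] at hv
    have := (hg (insert v B)).2.1 (right_ne_zero_of_mul (right_ne_zero_of_mul hne))
    rw [Finset.card_insert_of_notMem hv] at this
    omega
  · have h1 : multidegreePart (s + finsetExponent B) (koszulD g) B ≠ 0 := by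
      rw [multidegreePart_add_finsetExponent]; exact mem_support_iff.1 hs
    rw [multidegreePart_koszulD, subsetBoundary] at h1
    obtain ⟨v, hv, hne⟩ := Finset.exists_ne_zero_of_sum_ne_zero h1
    simp only [Finset.mem_sdiff, Finset.mem_univ, true_and] at hv
    have h2 := right_ne_zero_of_mul hne
    unfold multidegreePart at h2
    split_ifs at h2 with hle
    · have h3 := (hg (insert v B)).2.2 _ (mem_support_iff.2 h2)
      have h4 := (hg (insert v B)).2.1 (fun h0 => h2 (by simp [h0]))
      have h5 : (s + finsetExponent B - finsetExponent (insert v B)).degree +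
          (finsetExponent (insert v B)).degree = (s + finsetExponent B).degree := by
        rw [← map_add, tsub_add_cancel_of_le hle]
      rw [map_add, degree_finsetExponent, degree_finsetExponent, h4] at h5
      rw [Finset.card_insert_of_notMem hv] at h4
      omega
    · exact absurd rfl h2

/-- If every multidegree `m` of total degree `q` has a variable that can be coned off the upper
Koszul complex of the initial ideal in homological degree `p`, then `Tor_p(K, I)_q = 0`. -/
theorem koszulCycles_le_koszulBoundaries {le : (σ →₀ ℕ) → (σ →₀ ℕ) → Prop}
    (hle : IsMonomialOrder le) {I : Ideal (MvPolynomial σ K)} (hI : IsGradedIdeal I) (p q : ℕ)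
    (hcone : ∀ m : σ →₀ ℕ, m.degree = q → HasConeApex (initialIdeal le I) p m) :
    koszulCycles I p q ≤ koszulBoundaries I p q := by
  classical
  have hfin : {m : σ →₀ ℕ | m.degree = q}.Finite :=
    (Finsupp.finite_of_degree_le q).subset fun m hm => le_of_eq hm
  set S : Finset (σ →₀ ℕ) := hfin.toFinset with hSdef
  have hS : ∀ m, m ∈ S ↔ m.degree = q := fun m => by simp [hSdef]
  -- Termination measure: the multidegrees of total degree `q` lying below one that occurs in `f`.
  -- This set is finite, so the order need not be well-founded.
  let low : (Finset σ → MvPolynomial σ K) → Finset (σ →₀ ℕ) := fun f =>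
    S.filter fun m => ∃ A, ∃ t, multidegreePart t f A ≠ 0 ∧ le m t
  have hdeg : ∀ f ∈ koszulChains I p q, ∀ t A, multidegreePart t f A ≠ 0 →
      t ∈ S ∧ A.card = p := by
    intro f hf t A h
    unfold multidegreePart at h
    split_ifs at h with hAt
    · have h1 := (hf A).2.1 (fun h0 => h (by simp [h0]))
      have h2 := (hf A).2.2 _ (mem_support_iff.2 h)
      refine ⟨(hS t).2 ?_, h1⟩
      rw [← h2, ← tsub_add_cancel_of_le hAt, map_add, degree_finsetExponent, h1]
      simp
    · exact absurd rfl h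
  suffices H : ∀ N : ℕ, ∀ f ∈ koszulCycles I p q, (low f).card = N →
      f ∈ koszulBoundaries I p q from fun f hf => H _ f hf rfl
  intro N
  induction N using Nat.strong_induction_on with
  | _ N ih =>
  intro f hf hN
  have hfc : f ∈ koszulChains I p q := hf.1
  have hfk : koszulD f = 0 := hf.2
  let D := S.filter fun t => ∃ A, multidegreePart t f A ≠ 0
  by_cases hD : D.Nonempty
  swap
  · have : f = 0 := by
      funext A
      ext u
      by_contra hne
      have hm : multidegreePart (u + finsetExponent A) f A ≠ 0 := by
        rw [multidegreePart_add_finsetExponent]; exact hne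
      exact hD ⟨_, Finset.mem_filter.2 ⟨(hdeg f hfc _ _ hm).1, A, hm⟩⟩
    rw [this]; exact zero_mem _
  obtain ⟨m, hmD, hmax⟩ := hle.exists_max D hD
  obtain ⟨hmS, A₀, hA₀⟩ := Finset.mem_filter.1 hmD
  have hmaxf : ∀ t A, multidegreePart t f A ≠ 0 → le t m := fun t A h =>
    hmax t (Finset.mem_filter.2 ⟨(hdeg f hfc _ _ h).1, A, h⟩)
  obtain ⟨v₀, hv₀, hA⟩ := hcone m ((hS m).1 hmS)
  -- By maximality of `m`, `x^(m - A)` is the leading monomial of `f A`; the apex property then puts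
  -- `x^(m - A - v₀)` in the initial ideal.
  have hlift : ∀ A : Finset σ, ∃ h ∈ I, v₀ ∉ A → multidegreePart m f A ≠ 0 →
      ∃ u, u + Finsupp.single v₀ 1 + finsetExponent A = m ∧ coeff u h = 1 ∧
        ∀ t ∈ h.support, le t u ∧ t.degree = u.degree := by
    intro A
    by_cases hgood : v₀ ∉ A ∧ multidegreePart m f A ≠ 0
    swap
    · exact ⟨0, I.zero_mem, fun h1 h2 => absurd ⟨h1, h2⟩ hgood⟩
    obtain ⟨hvA, hne⟩ := hgood
    have hcard := (hdeg f hfc m A hne).2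
    have hAm : finsetExponent A ≤ m := by
      by_contra hcon
      exact hne (if_neg hcon)
    obtain ⟨w, rfl⟩ := exists_add_of_le hAm
    have hw : Finsupp.single v₀ 1 ≤ w := by
      rw [Finsupp.single_le_iff]
      simpa [finsetExponent_apply, hvA] using hv₀
    obtain ⟨u, rfl⟩ := exists_add_of_le hw
    have heq : u + Finsupp.single v₀ 1 + finsetExponent A =
        finsetExponent A + (Finsupp.single v₀ 1 + u) := by abel
    have hin : monomial (u + Finsupp.single v₀ 1) (1 : K) ∈ initialIdeal le I := by
      rw [monomial_mem_initialIdeal_iff hle]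
      refine ⟨f A, (hfc A).1, ?_, fun t ht => ?_⟩
      · rw [← heq, multidegreePart_add_finsetExponent] at hne
        exact mem_support_iff.2 hne
      · have := hmaxf (t + finsetExponent A) A (by
          rw [multidegreePart_add_finsetExponent]; exact mem_support_iff.1 ht)
        rw [← heq] at this
        exact hle.le_of_add_le_add this
    obtain ⟨h, hhI, hh1, hh2⟩ := exists_homogeneous_lift hle hI (hA A hcard hvA u heq hin)
    exact ⟨h, hhI, fun _ _ => ⟨u, heq, hh1, hh2⟩⟩
  choose h hhI hh using hlift
  -- The cone over the leading part, with each monomial replaced by its lift to `I`.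
  let g : Finset σ → MvPolynomial σ K := fun B =>
    if v₀ ∈ B then
      C ((-1) ^ ((B.erase v₀).filter (· < v₀)).card * multidegreePart m f (B.erase v₀)) *
        h (B.erase v₀)
    else 0
  have hg_supp : ∀ B, ∀ t ∈ (g B).support, v₀ ∈ B ∧ multidegreePart m f (B.erase v₀) ≠ 0 ∧
      t ∈ (h (B.erase v₀)).support := by
    intro B t ht
    rw [mem_support_iff] at ht
    by_cases hB : v₀ ∈ B
    · simp only [g, if_pos hB, coeff_C_mul] at ht
      exact ⟨hB, right_ne_zero_of_mul (left_ne_zero_of_mul ht),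
        mem_support_iff.2 (right_ne_zero_of_mul ht)⟩
    · simp [g, if_neg hB] at ht
  have hg_le : ∀ B, ∀ t ∈ (g B).support, le (t + finsetExponent B) m ∧
      B.card = p + 1 ∧ t.degree + (p + 1) = q := by
    intro B t ht
    obtain ⟨hB, hne, hth⟩ := hg_supp B t ht
    obtain ⟨u, hu, -, h2⟩ := hh (B.erase v₀) (by simp) hne
    obtain ⟨h3, h4⟩ := h2 t hth
    have hcard := (hdeg f hfc m _ hne).2
    have hBe : finsetExponent B = Finsupp.single v₀ 1 + finsetExponent (B.erase v₀) := by
      rw [← finsetExponent_insert (by simp), Finset.insert_erase hB]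
    refine ⟨?_, ?_, ?_⟩
    · have := hle.add_le_add _ _ (finsetExponent B) h3
      rwa [hBe, ← add_assoc u, hu, ← hBe] at this
    · rw [← hcard, Finset.card_erase_add_one hB]
    · have := congrArg Finsupp.degree hu
      rw [map_add, map_add, (hS m).1 hmS, degree_finsetExponent, hcard] at this
      simp only [Finsupp.degree_single] at this
      omega
  have hgc : g ∈ koszulChains I (p + 1) q := by
    intro B
    refine ⟨?_, fun hne => ?_, fun t ht => (hg_le B t ht).2.2⟩
    · simp only [g]
      split_ifs
      · exact I.mul_mem_left _ (hhI _)
      · exact I.zero_mem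
    · obtain ⟨t, ht⟩ := support_nonempty.2 hne
      exact (hg_le B t ht).2.1
  have hpart : multidegreePart m g = coneOperator v₀ (multidegreePart m f) := by
    funext B
    by_cases hB : v₀ ∈ B
    · have hBe : finsetExponent B = Finsupp.single v₀ 1 + finsetExponent (B.erase v₀) := by
        rw [← finsetExponent_insert (by simp), Finset.insert_erase hB]
      rw [coneOperator, if_pos hB]
      by_cases hne : multidegreePart m f (B.erase v₀) = 0
      · have hgB : g B = 0 := by simp only [g, if_pos hB, hne, mul_zero, map_zero, zero_mul]
        rw [hne, mul_zero, multidegreePart, hgB, coeff_zero, ite_self]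
      · obtain ⟨u, hu, h1, -⟩ := hh (B.erase v₀) (by simp) hne
        have hmu : m = u + finsetExponent B := by rw [← hu, hBe, add_assoc]
        have : multidegreePart m g B = coeff u (g B) := by
          rw [hmu, multidegreePart_add_finsetExponent]
        rw [this]
        simp only [g, if_pos hB, coeff_C_mul, h1, mul_one]
    · simp [coneOperator, multidegreePart, g, hB]
  have hdg : koszulD g ∈ koszulChains I p q := koszulD_mem_koszulChains hgc
  have hbd : koszulD g ∈ koszulBoundaries I p q := ⟨g, hgc, rfl⟩
  have hfg : f - koszulD g ∈ koszulCycles I p q := by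
    refine ⟨Submodule.sub_mem _ hfc hdg, ?_⟩
    rw [SetLike.mem_coe, LinearMap.mem_ker, map_sub, hfk, koszulD_comp, sub_zero]
  have hnew : ∀ t A, multidegreePart t (f - koszulD g) A ≠ 0 → le t m ∧ t ≠ m := by
    intro t A hne
    constructor
    · rw [multidegreePart_sub] at hne
      by_cases h1 : multidegreePart t f A = 0
      · rw [h1, zero_sub, neg_ne_zero, multidegreePart_koszulD] at hne
        obtain ⟨v, hv, hne⟩ := Finset.exists_ne_zero_of_sum_ne_zero hne
        have h2 := right_ne_zero_of_mul hne
        unfold multidegreePart at h2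
        split_ifs at h2 with h3
        · have := (hg_le _ _ (mem_support_iff.2 h2)).1
          rwa [tsub_add_cancel_of_le h3] at this
        · exact absurd rfl h2
      · exact hmaxf t A h1
    · rintro rfl
      apply hne
      rw [multidegreePart_sub, multidegreePart_koszulD, hpart, subsetBoundary_coneOperator,
        sub_self]
      intro B
      rw [← multidegreePart_koszulD, hfk]
      simp [multidegreePart]
  have hlt : (low (f - koszulD g)).card < N := by
    rw [← hN]
    apply Finset.card_lt_card
    rw [Finset.ssubset_iff_of_subset]
    · refine ⟨m, Finset.mem_filter.2 ⟨hmS, A₀, m, hA₀, hle.refl m⟩, fun hm => ?_⟩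
      obtain ⟨-, A, t, ht, hmt⟩ := Finset.mem_filter.1 hm
      obtain ⟨h1, h2⟩ := hnew t A ht
      exact h2 (hle.antisymm _ _ h1 hmt)
    · intro s hs
      obtain ⟨hsS, A, t, ht, hst⟩ := Finset.mem_filter.1 hs
      exact Finset.mem_filter.2 ⟨hsS, A₀, m, hA₀, hle.trans _ _ _ hst (hnew t A ht).1⟩
  have := ih _ hlt _ hfg rfl
  have h2 := Submodule.add_mem _ this hbd
  rwa [sub_add_cancel] at h2

theorem not_nontrivial_gradedTor {I : Ideal (MvPolynomial σ K)} {p q : ℕ}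
    (h : koszulCycles I p q ≤ koszulBoundaries I p q) : ¬ Nontrivial (gradedTor I p q) := by
  rw [not_nontrivial_iff_subsingleton, gradedTor, Submodule.Quotient.subsingleton_iff,
    Submodule.submoduleOf_eq_top]
  exact h

end KoszulVanishing

/-! ### Chains of monomial ideals as sets of column sequences

A monomial of `R_n` is encoded by the sequence of its columns, a function `ℕ → Fin c → ℕ` of which
only the values at `j < n` matter. -/

section ColumnChains

variable {c : ℕ}

/-- Chains of up-sets of column sequences that are closed under `Inc(ℕ)^i`. -/
def IsIncClosed (i : ℕ) (M : ℕ → Set (ℕ → Fin c → ℕ)) : Prop :=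
  ∀ m n : ℕ, 1 ≤ m → m ≤ n → ∀ π : ℕ → ℕ, (∀ j l, j < l → l < m → π j < π l) →
    (∀ j < m, π j < n) → (∀ j < m, j < i → π j = j) → ∀ u ∈ M m, ∀ v : ℕ → Fin c → ℕ,
      (∀ j < m, u j ≤ v (π j)) → v ∈ M n

/-- The strictly increasing map whose image misses exactly `d`. -/
def skipIndex (d j : ℕ) : ℕ := if j < d then j else j + 1

variable {i : ℕ} {M : ℕ → Set (ℕ → Fin c → ℕ)}

theorem IsIncClosed.upward (hM : IsIncClosed i M) {m n : ℕ} (hm : 1 ≤ m) (hmn : m ≤ n)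
    {u v : ℕ → Fin c → ℕ} (hu : u ∈ M m) (huv : ∀ j < m, u j ≤ v j) : v ∈ M n :=
  hM m n hm hmn id (fun _ _ h _ => h) (fun _ hj => hj.trans_le hmn) (fun _ _ _ => rfl) u hu v huv

/-- A column sequence lies in `M n` as soon as it has enough large columns. -/
theorem IsIncClosed.mem_of_card_le (hM : IsIncClosed i M) {p m n : ℕ} (hp : i ≤ p) (hm : 1 ≤ m)
    (hmn : m ≤ n) {u v : ℕ → Fin c → ℕ} (hu : u ∈ M m) (T : Finset ℕ)
    (hT : ∀ l ∈ T, p ≤ l ∧ l < n) (hcard : m ≤ T.card)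
    (hlow : ∀ j < p, j < m → u j ≤ v j) (hhigh : ∀ j < m, p ≤ j → ∀ l ∈ T, u j ≤ v l) :
    v ∈ M n := by
  -- The first `p` columns stay in place and the later ones go to `T` in increasing order. Only `m -
  -- p` places are needed; asking for `m` avoids a subtraction.
  let π : ℕ → ℕ := fun j =>
    if j < p then j else if h : j - p < T.card then T.orderEmbOfFin rfl ⟨j - p, h⟩ else j
  have hπlow : ∀ j < p, π j = j := fun j hj => if_pos hj
  have hπhigh : ∀ j, p ≤ j → ∀ h : j - p < T.card, π j = T.orderEmbOfFin rfl ⟨j - p, h⟩ :=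
    fun j hj h => by simp only [π, if_neg hj.not_gt, dif_pos h]
  have hπT : ∀ j, p ≤ j → j < m → π j ∈ T := fun j hj hjm => by
    rw [hπhigh j hj (by omega)]
    exact Finset.orderEmbOfFin_mem _ _ _
  refine hM m n hm hmn π (fun j l hjl hl => ?_) (fun j hj => ?_)
    (fun j _ hji => hπlow j (hji.trans_le hp)) u hu v (fun j hj => ?_)
  · rcases lt_or_ge l p with h | h
    · rwa [hπlow j (hjl.trans h), hπlow l h]
    · rcases lt_or_ge j p with h' | h'
      · rw [hπlow j h']
        exact h'.trans_le (hT _ (hπT l h hl)).1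
      · rw [hπhigh j h' (by omega), hπhigh l h (by omega)]
        apply (T.orderEmbOfFin rfl).strictMono
        rw [Fin.mk_lt_mk]
        omega
  · rcases lt_or_ge j p with h | h
    · rw [hπlow j h]; exact hj.trans_le hmn
    · exact (hT _ (hπT j h hj)).2
  · rcases lt_or_ge j p with h | h
    · rw [hπlow j h]; exact hlow j h hj
    · exact hhigh j hj h _ (hπT j h hj)

/-- Noetherianity up to symmetry: in large width, every member of the chain comes from the
previous width by inserting a column. -/
theorem IsIncClosed.exists_skip (hM : IsIncClosed i M) (p : ℕ) (hp : i ≤ p) :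
    ∃ n₀, 1 ≤ n₀ ∧ p ≤ n₀ ∧ ∀ n ≥ n₀, ∀ v ∈ M (n + 1), ∃ d, p ≤ d ∧ d ≤ n ∧
      (fun j => v (skipIndex d j)) ∈ M n := by
  by_contra hcon
  push Not at hcon
  have hfreq : ∃ᶠ n in atTop, (1 ≤ n ∧ p ≤ n) ∧ ∃ v ∈ M (n + 1), ∀ d, p ≤ d → d ≤ n →
      (fun j => v (skipIndex d j)) ∉ M n := by
    rw [frequently_atTop]
    intro a
    obtain ⟨n, hn, v, hv, h⟩ := hcon (max a (max 1 p)) (by simp) (by simp)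
    exact ⟨n, le_trans (by simp) hn, ⟨le_trans (by simp) hn, le_trans (by simp) hn⟩, v, hv, h⟩
  obtain ⟨φ, hφ, hP⟩ := extraction_of_frequently_atTop hfreq
  choose hφp v hv hbad using hP
  -- Higman's lemma over columns, which are well-quasi-ordered by Dickson's lemma. The first `p`
  -- columns must not move and are compared separately.
  have hwqo : WellQuasiOrdered (List.SublistForall₂ (α := Fin c → ℕ) (· ≤ ·)) := by
    rw [← Set.partiallyWellOrderedOn_univ_iff]
    have := Set.PartiallyWellOrderedOn.partiallyWellOrderedOn_sublistForall₂
      (α := Fin c → ℕ) (s := Set.univ) (· ≤ ·)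
      (Set.partiallyWellOrderedOn_univ_iff.2 wellQuasiOrdered_le)
    simpa using this
  have hwqo2 := (wellQuasiOrdered_le (α := Fin p → Fin c → ℕ)).prod hwqo
  obtain ⟨a, b, hab, h1, h2⟩ := hwqo2 (fun k => (fun j : Fin p => v k j,
    List.ofFn fun j : Fin (φ k + 1 - p) => v k (p + j)))
  simp only at h1 h2
  have hlt : φ a < φ b := hφ hab
  have hpa := (hφp a).2
  have hpb := (hφp b).2
  obtain ⟨l, hl1, hl2⟩ := List.sublistForall₂_iff.1 h2
  obtain ⟨f, hf⟩ := List.sublist_iff_exists_fin_orderEmbedding_get_eq.1 hl2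
  obtain ⟨hlen, hget⟩ := List.forall₂_iff_get.1 hl1
  have hlen1 : l.length = φ a + 1 - p := by rw [← hlen, List.length_ofFn]
  have hlen2 : (List.ofFn fun j : Fin (φ b + 1 - p) => v b (p + j)).length = φ b + 1 - p :=
    List.length_ofFn
  have hfv : ∀ x : Fin l.length, v a (p + x) ≤ v b (p + f x) := by
    intro x
    have h3 := hget x (by rw [List.length_ofFn, ← hlen1]; exact x.2) x.2
    have h4 := hf x
    simp only [List.get_eq_getElem, List.getElem_ofFn] at h3 h4
    rw [← h4]
    exact h3
  -- `φ a < φ b`, so the embedding of tails misses a column. Deleting it from `v b` leaves a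
  -- sequence that still dominates `v a` along an increasing map, contradicting badness.
  obtain ⟨e, he⟩ : ∃ e, e ∉ Set.range f := by
    by_contra hall
    push Not at hall
    have := Fintype.card_le_of_surjective f hall
    rw [Fintype.card_fin, Fintype.card_fin, hlen1, hlen2] at this
    omega
  have heb : (e : ℕ) < φ b + 1 - p := lt_of_lt_of_eq e.2 hlen2
  let π : ℕ → ℕ := fun j =>
    if j < p then j else if h : j - p < l.length then p + f ⟨j - p, h⟩ else j
  have hπlow : ∀ j < p, π j = j := fun j hj => if_pos hj
  have hπhigh : ∀ j, p ≤ j → ∀ h : j - p < l.length, π j = p + f ⟨j - p, h⟩ :=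
    fun j hj h => by simp only [π, if_neg hj.not_gt, dif_pos h]
  have hπne : ∀ j < φ a + 1, π j ≠ p + e := by
    intro j hj
    rcases lt_or_ge j p with h | h
    · rw [hπlow j h]; omega
    · rw [hπhigh j h (by omega)]
      intro heq
      exact he ⟨⟨j - p, by omega⟩, Fin.ext (by omega)⟩
  have hπlt : ∀ j < φ a + 1, π j < φ b + 1 := by
    intro j hj
    rcases lt_or_ge j p with h | h
    · rw [hπlow j h]; omega
    · rw [hπhigh j h (by omega)]
      have := lt_of_lt_of_eq (f ⟨j - p, by omega⟩).2 hlen2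
      omega
  have hπmono : ∀ j k, j < k → k < φ a + 1 → π j < π k := by
    intro j k hjk hk
    rcases lt_or_ge k p with h | h
    · rwa [hπlow j (hjk.trans h), hπlow k h]
    · rcases lt_or_ge j p with h' | h'
      · rw [hπlow j h', hπhigh k h (by omega)]; omega
      · rw [hπhigh j h' (by omega), hπhigh k h (by omega)]
        have : f ⟨j - p, by omega⟩ < f ⟨k - p, by omega⟩ := by
          apply f.strictMono
          rw [Fin.mk_lt_mk]; omega
        have : ((f ⟨j - p, by omega⟩ : Fin _) : ℕ) < f ⟨k - p, by omega⟩ := this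
        omega
  refine hbad b (p + e) (by omega) (by omega) ?_
  refine hM (φ a + 1) (φ b) (by omega) (by omega)
    (fun j => if π j < p + e then π j else π j - 1) (fun j k hjk hk => ?_) (fun j hj => ?_)
    (fun j hj hji => ?_) _ (hv a) _ (fun j hj => ?_)
  · have h3 := hπmono j k hjk hk
    have h4 := hπne j (hjk.trans hk)
    have h5 := hπne k hk
    split_ifs <;> omega
  · have h3 := hπlt j hj
    have h4 := hπne j hj
    split_ifs <;> omega
  · have h3 := hπlow j (by omega)
    rw [h3, if_pos (by omega)]
  · have h4 := hπne j hj
    have hskip : skipIndex (p + e) (if π j < p + e then π j else π j - 1) = π j := by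
      unfold skipIndex
      split_ifs <;> omega
    rw [hskip]
    rcases lt_or_ge j p with h | h
    · rw [hπlow j h]
      exact h1 ⟨j, h⟩
    · rw [hπhigh j h (by omega)]
      have := hfv ⟨j - p, by omega⟩
      simpa [Nat.add_sub_cancel' h] using this

open Classical in
/-- Truncation at `t` of the entries in the positions `S`. -/
def truncateCols (S : ℕ → Fin c → Prop) (t : ℕ) (v : ℕ → Fin c → ℕ) : ℕ → Fin c → ℕ :=
  fun j k => if S j k then min (v j k) t else v j k

theorem truncateCols_le (S : ℕ → Fin c → Prop) (t : ℕ) (v : ℕ → Fin c → ℕ) :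
    truncateCols S t v ≤ v := by
  intro j k
  unfold truncateCols
  split_ifs
  · exact min_le_left _ _
  · exact le_rfl

/-- Delete a column, truncate in width `n`, and reinsert the column: the inserted column may be
arbitrary, in particular truncated. The condition on `S` makes truncation commute with the deletion.
-/
theorem truncateCols_succ_mem (hM : IsIncClosed i M) {p n : ℕ} (hp : i ≤ p) (hn : 1 ≤ n)
    (hskip : ∀ v ∈ M (n + 1), ∃ d, p ≤ d ∧ d ≤ n ∧ (fun j => v (skipIndex d j)) ∈ M n)
    {S : ℕ → Fin c → Prop} (hS : ∀ d j k, p ≤ d → (S (skipIndex d j) k ↔ S j k)) {t : ℕ}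
    (h : ∀ v ∈ M n, truncateCols S t v ∈ M n) :
    ∀ v ∈ M (n + 1), truncateCols S t v ∈ M (n + 1) := by
  intro v hv
  obtain ⟨d, hd, hdn, hvd⟩ := hskip v hv
  refine hM n (n + 1) hn (by omega) (skipIndex d) (fun j l hjl _ => ?_) (fun j hj => ?_)
    (fun j _ hji => ?_) _ (h _ hvd) _ (fun j _ k => ?_)
  · unfold skipIndex; split_ifs <;> omega
  · unfold skipIndex; split_ifs <;> omega
  · unfold skipIndex; rw [if_pos]; omega
  · unfold truncateCols
    have hSd := hS d j k hd
    by_cases hs : S j k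
    · rw [if_pos hs, if_pos (hSd.2 hs)]
    · rw [if_neg hs, if_neg (mt hSd.1 hs)]

end ColumnChains

/-! ### Translation between ideals of `R_n` and column sequences -/

section ColumnsOfIdeals

variable {K : Type*} [Field K] {c : ℕ}

/-- The exponent vector in `R_n` of a column sequence. -/
def ofCols (n : ℕ) (v : ℕ → Fin c → ℕ) : FinVar c n →₀ ℕ :=
  Finsupp.equivFunOnFinite.symm fun x => v (ofLex x).2 (ofLex x).1

/-- The column sequence of an exponent vector, extended by zero. -/
def toCols {n : ℕ} (u : FinVar c n →₀ ℕ) : ℕ → Fin c → ℕ :=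
  fun j k => if h : j < n then u (toLex (k, ⟨j, h⟩)) else 0

theorem ofCols_apply (n : ℕ) (v : ℕ → Fin c → ℕ) (k : Fin c) (j : Fin n) :
    ofCols n v (toLex (k, j)) = v j k := rfl

theorem toCols_apply {n : ℕ} (u : FinVar c n →₀ ℕ) (k : Fin c) (j : Fin n) :
    toCols u j k = u (toLex (k, j)) := by
  simp [toCols]

theorem ofCols_toCols {n : ℕ} (u : FinVar c n →₀ ℕ) : ofCols n (toCols u) = u := by
  ext x
  exact toCols_apply u (ofLex x).1 (ofLex x).2

theorem ofCols_mono (n : ℕ) {u v : ℕ → Fin c → ℕ} (h : u ≤ v) : ofCols n u ≤ ofCols n v :=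
  fun x => h (ofLex x).2 (ofLex x).1

/-- The column sequences of the monomials in a sequence of ideals. -/
def colSet (J : (n : ℕ) → Ideal (MvPolynomial (FinVar c n) K)) (n : ℕ) :
    Set (ℕ → Fin c → ℕ) :=
  {v | monomial (ofCols n v) (1 : K) ∈ J n}

theorem toCols_mem_colSet {J : (n : ℕ) → Ideal (MvPolynomial (FinVar c n) K)} {n : ℕ}
    {u : FinVar c n →₀ ℕ} : toCols u ∈ colSet J n ↔ monomial u (1 : K) ∈ J n := by
  rw [colSet, Set.mem_ofPred_eq, ofCols_toCols]

theorem zero_mem_colSet {J : (n : ℕ) → Ideal (MvPolynomial (FinVar c n) K)} {n : ℕ} :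
    (0 : ℕ → Fin c → ℕ) ∈ colSet J n ↔ monomial (0 : FinVar c n →₀ ℕ) (1 : K) ∈ J n := by
  have : ofCols n (0 : ℕ → Fin c → ℕ) = 0 := by
    ext x
    rfl
  rw [colSet, Set.mem_ofPred_eq, this]

theorem monomial_mem_of_le {τ : Type*} {J : Ideal (MvPolynomial τ K)} {u v : τ →₀ ℕ}
    (hu : monomial u (1 : K) ∈ J) (huv : u ≤ v) : monomial v (1 : K) ∈ J := by
  obtain ⟨d, rfl⟩ := exists_add_of_le huv
  have := J.mul_mem_left (monomial d 1) hu
  rwa [monomial_mul, one_mul, add_comm] at this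

theorem varIncl_injective (c n : ℕ) : Function.Injective (varIncl c n) := by
  intro x y h
  simp only [varIncl, Prod.mk.injEq] at h
  exact ofLex.injective (Prod.ext h.1 (Fin.ext h.2))

theorem varAct_injective (c : ℕ) {π : ℕ → ℕ} (hπ : StrictMono π) :
    Function.Injective (varAct c π) := by
  intro x y h
  simp only [varAct, Prod.mk.injEq] at h
  exact Prod.ext h.1 (hπ.injective h.2)

theorem isMonomialOrder_restrictOrder {le : (InfVar c →₀ ℕ) → (InfVar c →₀ ℕ) → Prop}
    (hle : IsMonomialOrder le) (n : ℕ) : IsMonomialOrder (restrictOrder le n) where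
  total _ _ := hle.total _ _
  antisymm _ _ h1 h2 :=
    Finsupp.mapDomain_injective (varIncl_injective c n) (hle.antisymm _ _ h1 h2)
  trans _ _ _ h1 h2 := hle.trans _ _ _ h1 h2
  zero_le u := by
    unfold restrictOrder
    rw [Finsupp.mapDomain_zero]
    exact hle.zero_le _
  add_le_add u v w h := by
    unfold restrictOrder
    rw [Finsupp.mapDomain_add, Finsupp.mapDomain_add]
    exact hle.add_le_add _ _ _ h

/-- Column sequences only see `π` on the first `m` indices; beyond them `j ↦ n + j` continues it
increasingly. -/
theorem exists_incMonoid_extension {i m n : ℕ} {π : ℕ → ℕ}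
    (hmono : ∀ j l, j < l → l < m → π j < π l) (hlt : ∀ j < m, π j < n)
    (hfix : ∀ j < m, j < i → π j = j) : ∃ ρ ∈ IncMonoid i, ∀ j < m, ρ j = π j := by
  rcases lt_or_ge m i with hi | hi
  · exact ⟨id, ⟨strictMono_id, fun _ _ => rfl⟩, fun j hj => (hfix j hj (hj.trans hi)).symm⟩
  · refine ⟨fun j => if j < m then π j else n + j, ⟨fun j l hjl => ?_, fun j hj => ?_⟩,
      fun j hj => if_pos hj⟩
    · rcases lt_or_ge l m with h | h
      · simp only [if_pos h, if_pos (hjl.trans h)]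
        exact hmono j l hjl h
      · rcases lt_or_ge j m with h' | h'
        · simp only [if_pos h', if_neg h.not_gt]
          exact (hlt j h').trans_le (by omega)
        · simp only [if_neg h'.not_gt, if_neg h.not_gt]
          omega
    · simp only [if_pos (hj.trans_le hi)]
      exact hfix j (hj.trans_le hi) hj

/-- The initial chain of an invariant chain is invariant. -/
theorem isIncClosed_initialChain {i : ℕ} {I : (n : ℕ) → Ideal (MvPolynomial (FinVar c n) K)}
    (hinv : IsIncInvariant i I) {le : (InfVar c →₀ ℕ) → (InfVar c →₀ ℕ) → Prop}
    (hle : IsMonomialOrder le) (hresp : RespectsInc i le) :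
    IsIncClosed i (colSet (initialChain le I)) := by
  classical
  intro m n hm hmn π hmono hlt hfix u hu v huv
  obtain ⟨ρ, hρ, hρπ⟩ := exists_incMonoid_extension hmono hlt hfix
  rw [colSet, Set.mem_ofPred_eq, initialChain,
    monomial_mem_initialIdeal_iff (isMonomialOrder_restrictOrder hle m)] at hu
  obtain ⟨f, hf, hs, hmax⟩ := hu
  obtain ⟨g, hg, hgf⟩ := hinv m n hm hmn ρ hρ (fun j hj => by rw [hρπ j hj]; exact hlt j hj) f hf
  have hinj_n := varIncl_injective c n
  have hinj_m := varIncl_injective c m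
  have hinj_ρ := varAct_injective c hρ.1
  -- All renamings are injective, so supports correspond; since the order respects `Inc(ℕ)^i`, so do
  -- leading monomials.
  have hsupp : g.support.image (Finsupp.mapDomain (varIncl c n)) =
      f.support.image fun t => (t.mapDomain (varIncl c m)).mapDomain (varAct c ρ) := by
    have h1 := congrArg support hgf
    rw [ringIncl, ringIncl, support_rename_of_injective hinj_n,
      support_rename_of_injective hinj_ρ, support_rename_of_injective hinj_m,
      Finset.image_image] at h1
    exact h1
  obtain ⟨s', hs', hs'eq⟩ := Finset.mem_image.1
    (hsupp ▸ Finset.mem_image_of_mem _ hs : (Finsupp.mapDomain (varAct c ρ)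
      (Finsupp.mapDomain (varIncl c m) (ofCols m u))) ∈ _)
  have hin : monomial s' (1 : K) ∈ initialChain le I n := by
    rw [initialChain, monomial_mem_initialIdeal_iff (isMonomialOrder_restrictOrder hle n)]
    refine ⟨g, hg, hs', fun t ht => ?_⟩
    obtain ⟨t₀, ht₀, ht₀eq⟩ := Finset.mem_image.1 (hsupp ▸ Finset.mem_image_of_mem _ ht :
      Finsupp.mapDomain (varIncl c n) t ∈ f.support.image fun t =>
        (t.mapDomain (varIncl c m)).mapDomain (varAct c ρ))
    unfold restrictOrder
    rw [hs'eq, ← ht₀eq]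
    exact hresp ρ hρ _ _ (hmax t₀ ht₀)
  refine monomial_mem_of_le hin fun x => ?_
  rw [← Finsupp.mapDomain_apply hinj_n s' x, hs'eq, ← Finsupp.mapDomain_comp]
  by_cases hx : varIncl c n x ∈ Set.range (varAct c ρ ∘ varIncl c m)
  · obtain ⟨y, hy⟩ := hx
    rw [← hy, Finsupp.mapDomain_apply (hinj_ρ.comp hinj_m)]
    simp only [varIncl, varAct, Function.comp_apply, Prod.mk.injEq] at hy
    have h1 := huv (ofLex y).2 (ofLex y).2.2 (ofLex y).1
    rw [← hρπ _ (ofLex y).2.2, hy.2, hy.1] at h1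
    change u (ofLex y).2 (ofLex y).1 ≤ v (ofLex x).2 (ofLex x).1
    rwa [hy.1]
  · rw [Finsupp.mapDomain_of_notMem_range _ _ hx]
    exact Nat.zero_le _

/-! ### Minimal generators and weights -/

theorem minGens_finite {τ : Type*} [Finite τ] (J : Ideal (MvPolynomial τ K)) :
    (minGens J).Finite := by
  apply WellQuasiOrderedLE.finite_of_isAntichain
  intro u hu v hv huv hle
  exact huv (hv.2 u hu.1 hle)

theorem exists_minGens_le {τ : Type*} [Finite τ] {J : Ideal (MvPolynomial τ K)} {u : τ →₀ ℕ}
    (hu : monomial u (1 : K) ∈ J) : ∃ g ∈ minGens J, g ≤ u := by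
  obtain ⟨g, hgu, hg⟩ := exists_minimal_le_of_wellFoundedLT
    (fun v : τ →₀ ℕ => monomial v (1 : K) ∈ J) u hu
  exact ⟨g, ⟨hg.1, fun v hv hvg => le_antisymm hvg (hg.2 hv hvg)⟩, hgu⟩

theorem sSup_image_minGens_le_iff {τ : Type*} [Finite τ] (J : Ideal (MvPolynomial τ K))
    (w : (τ →₀ ℕ) → ℕ) (t : ℕ) : sSup (w '' minGens J) ≤ t ↔ ∀ g ∈ minGens J, w g ≤ t := by
  constructor
  · intro h g hg
    exact (le_csSup ((minGens_finite J).image w).bddAbove ⟨g, hg, rfl⟩).trans h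
  · intro h
    refine csSup_le' ?_
    rintro _ ⟨g, hg, rfl⟩
    exact h g hg

variable {n : ℕ}

theorem rowWeight_le_iff (p : ℕ) (k : Fin c) (u : FinVar c n →₀ ℕ) (t : ℕ) :
    rowWeight p k u ≤ t ↔ ∀ j : Fin n, p ≤ j → u (toLex (k, j)) ≤ t := by
  simp [rowWeight, Finset.sup_le_iff]

theorem weight_le_iff (p : ℕ) (u : FinVar c n →₀ ℕ) (t : ℕ) :
    weight p u ≤ t ↔ ∀ k, rowWeight p k u ≤ t := by
  simp [weight, Finset.sup_le_iff]

theorem idealRowWeight_le_iff (p : ℕ) (k : Fin c) (J : Ideal (MvPolynomial (FinVar c n) K))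
    (t : ℕ) : idealRowWeight p k J ≤ t ↔
      ∀ g ∈ minGens J, ∀ j : Fin n, p ≤ j → g (toLex (k, j)) ≤ t := by
  rw [idealRowWeight, sSup_image_minGens_le_iff]
  simp only [rowWeight_le_iff]

theorem sSup_weight_minGens (p : ℕ) (J : Ideal (MvPolynomial (FinVar c n) K)) :
    sSup (weight p '' minGens J) = Finset.univ.sup fun k => idealRowWeight p k J := by
  refine eq_of_forall_ge_iff fun t => ?_
  rw [sSup_image_minGens_le_iff, Finset.sup_le_iff]
  simp only [weight_le_iff, idealRowWeight, sSup_image_minGens_le_iff, Finset.mem_univ,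
    true_imp_iff]
  exact ⟨fun h k g hg => h g hg k, fun h g hg k => h k g hg⟩

theorem idealRowWeight_anti {p q : ℕ} (hpq : p ≤ q) (k : Fin c)
    (J : Ideal (MvPolynomial (FinVar c n) K)) : idealRowWeight q k J ≤ idealRowWeight p k J :=
  (idealRowWeight_le_iff q k J _).2 fun g hg j hj =>
    (idealRowWeight_le_iff p k J _).1 le_rfl g hg j (hpq.trans hj)

/-- A bound for exponents of minimal generators amounts to stability under truncation. -/
theorem truncateCols_mem_iff (J : (n : ℕ) → Ideal (MvPolynomial (FinVar c n) K)) (n : ℕ)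
    (S : ℕ → Fin c → Prop) (t : ℕ) :
    (∀ v ∈ colSet J n, truncateCols S t v ∈ colSet J n) ↔
      ∀ g ∈ minGens (J n), ∀ (k : Fin c) (j : Fin n), S j k → g (toLex (k, j)) ≤ t := by
  constructor
  · intro h g hg k j hS
    have h1 := h (toCols g) (toCols_mem_colSet.2 hg.1)
    have h2 := hg.2 _ h1 (by
      conv_rhs => rw [← ofCols_toCols g]
      exact ofCols_mono n (truncateCols_le S t _))
    rw [← h2, ofCols_apply, truncateCols, if_pos hS]
    exact min_le_right _ _
  · intro h v hv
    obtain ⟨g, hg, hgv⟩ := exists_minGens_le hv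
    refine monomial_mem_of_le hg.1 fun x => ?_
    have h1 := hgv x
    have h2 := h g hg (ofLex x).1 (ofLex x).2
    change g x ≤ v (ofLex x).2 (ofLex x).1 at h1
    change g x ≤ truncateCols S t v (ofLex x).2 (ofLex x).1
    unfold truncateCols
    split_ifs with hS
    · exact le_min h1 (h2 hS)
    · exact h1

theorem eventually_const_of_succ_le {a : ℕ → ℕ} {n₀ : ℕ} (h : ∀ n ≥ n₀, a (n + 1) ≤ a n) :
    ∃ A, ∀ᶠ n in atTop, a n = A := by
  have hanti : ∀ m n, n₀ ≤ m → m ≤ n → a n ≤ a m := by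
    intro m n hm hmn
    induction n, hmn using Nat.le_induction with
    | base => exact le_rfl
    | succ n hmn ih => exact (h n (hm.trans hmn)).trans ih
  have hne : (a '' Set.Ici n₀).Nonempty := ⟨a n₀, n₀, Set.mem_Ici.2 le_rfl, rfl⟩
  obtain ⟨m, hm, hmA⟩ := Nat.sInf_mem hne
  refine ⟨a m, eventually_atTop.2 ⟨m, fun n hn => le_antisymm (hanti m n hm hn) ?_⟩⟩
  rw [hmA]
  exact Nat.sInf_le ⟨n, le_trans hm hn, rfl⟩

theorem eventualValue_eq {a : ℕ → ℕ} {v : ℕ} (h : ∀ᶠ n in atTop, a n = v) :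
    eventualValue a = v := by
  have hset : {w | ∀ᶠ n in atTop, a n = w} = {v} := by
    ext w
    refine ⟨fun hw => ?_, fun hw => by rw [Set.mem_singleton_iff.1 hw]; exact h⟩
    obtain ⟨n, h1, h2⟩ := (hw.and h).exists
    exact h1.symm.trans h2
  rw [eventualValue, hset, csInf_singleton]

theorem eventualValue_eventualValue_eq {a : ℕ → ℕ → ℕ} {v : ℕ}
    (h : ∀ᶠ p in atTop, ∀ᶠ n in atTop, a p n = v) :
    eventualValue (fun p => eventualValue (a p)) = v :=
  eventualValue_eq (h.mono fun _ hp => eventualValue_eq hp)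

/-! ### Stabilisation of the weights along the chain -/

section Chain

variable {i : ℕ} {J : (n : ℕ) → Ideal (MvPolynomial (FinVar c n) K)}

/-- The weight is the least truncation level preserving the ideal, so it is eventually
non-increasing in `n`. -/
theorem exists_eventually_idealRowWeight_eq (hJ : IsIncClosed i (colSet J)) (k : Fin c) {p : ℕ}
    (hp : i ≤ p) : ∃ w, ∀ᶠ n in atTop, idealRowWeight p k (J n) = w := by
  obtain ⟨n₀, hn₀, -, hskip⟩ := hJ.exists_skip p hp
  refine eventually_const_of_succ_le (n₀ := n₀) fun n hn => ?_
  have hS : ∀ d j (k' : Fin c), p ≤ d →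
      ((k' = k ∧ p ≤ skipIndex d j) ↔ (k' = k ∧ p ≤ j)) := by
    intro d j k' hd
    have : p ≤ skipIndex d j ↔ p ≤ j := by
      unfold skipIndex; split_ifs <;> omega
    rw [this]
  have hiff : ∀ n t, idealRowWeight p k (J n) ≤ t ↔ ∀ v ∈ colSet J n,
      truncateCols (fun j k' => k' = k ∧ p ≤ j) t v ∈ colSet J n := by
    intro n t
    rw [truncateCols_mem_iff, idealRowWeight_le_iff]
    constructor
    · rintro h g hg k' j ⟨rfl, hj⟩
      exact h g hg j hj
    · exact fun h g hg j hj => h g hg k j ⟨rfl, hj⟩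
  rw [hiff]
  exact truncateCols_succ_mem hJ hp (hn₀.trans hn) (hskip n hn) hS ((hiff n _).1 le_rfl)

theorem exists_eventually_eventually_idealRowWeight_eq (hJ : IsIncClosed i (colSet J))
    (k : Fin c) : ∃ w, ∀ᶠ p in atTop, ∀ᶠ n in atTop, idealRowWeight p k (J n) = w := by
  choose! a ha using fun p (hp : i ≤ p) => exists_eventually_idealRowWeight_eq hJ k hp
  obtain ⟨w, hw⟩ := eventually_const_of_succ_le (a := a) (n₀ := i) fun p hp => by
    obtain ⟨n, h1, h2⟩ := ((ha p hp).and (ha (p + 1) (by omega))).exists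
    rw [← h1, ← h2]
    exact idealRowWeight_anti (by omega) k _
  refine ⟨w, ?_⟩
  filter_upwards [hw, eventually_ge_atTop i] with p hpw hp
  rw [← hpw]
  exact ha p hp

/-- The exponents of the minimal generators are bounded along the chain. -/
theorem exists_bound_minGens (hJ : IsIncClosed i (colSet J)) :
    ∃ W, ∀ᶠ n in atTop, ∀ g ∈ minGens (J n), ∀ x, g x ≤ W := by
  obtain ⟨n₀, hn₀, -, hskip⟩ := hJ.exists_skip i le_rfl
  obtain ⟨W, hW⟩ : ∃ W, ∀ g ∈ minGens (J n₀), ∀ x, g x ≤ W := by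
    refine ⟨sSup ((fun g : FinVar c n₀ →₀ ℕ => g.degree) '' minGens (J n₀)), fun g hg x => ?_⟩
    exact (Finsupp.le_degree x g).trans ((sSup_image_minGens_le_iff _ _ _).1 le_rfl g hg)
  refine ⟨W, eventually_atTop.2 ⟨n₀, fun n hn => ?_⟩⟩
  have key : ∀ v ∈ colSet J n, truncateCols (fun _ _ => True) W v ∈ colSet J n := by
    induction n, hn using Nat.le_induction with
    | base => exact (truncateCols_mem_iff J n₀ _ W).2 fun g hg k j _ => hW g hg _
    | succ n hn ih =>
      exact truncateCols_succ_mem hJ le_rfl (hn₀.trans hn) (hskip n hn) (by simp) ih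
  intro g hg x
  exact (truncateCols_mem_iff J n _ W).1 key g hg (ofLex x).1 (ofLex x).2 trivial

/-! ### The eventual value of `ω` -/

theorem eventually_idealOmega_of_zero_mem (hJ : IsIncClosed i (colSet J))
    (h : ∃ n ≥ 1, (0 : ℕ → Fin c → ℕ) ∈ colSet J n) (p : ℕ) :
    ∀ᶠ n in atTop, idealOmega p (J n) = 0 := by
  obtain ⟨m, hm, h0⟩ := h
  filter_upwards [eventually_ge_atTop m] with n hn
  have h1 : monomial (0 : FinVar c n →₀ ℕ) (1 : K) ∈ J n :=
    zero_mem_colSet.1 (hJ.upward hm hn h0 fun _ _ => le_rfl)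
  have hzero : ∀ g ∈ minGens (J n), g = 0 := fun g hg => (hg.2 0 h1 (zero_le)).symm
  have hempty : ¬ (minGensPlus p (J n)).Nonempty := fun ⟨g, hg⟩ => hg.2.1 (hzero g hg.1)
  rw [idealOmega, if_neg hempty, ← Nat.le_zero, sSup_image_minGens_le_iff]
  intro g hg
  rw [hzero g hg, weight_le_iff]
  intro k
  rw [rowWeight_le_iff]
  intro j _
  simp

/-- The value `e` is the least entry bound among all monomials of the chain avoiding the first `i`
columns. It does not depend on `p`, because such a monomial can be shifted past column `p`. -/
theorem eventually_idealOmega_of_exists (hJ : IsIncClosed i (colSet J))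
    (h0 : ¬ ∃ n ≥ 1, (0 : ℕ → Fin c → ℕ) ∈ colSet J n)
    (h : ∃ n ≥ 1, ∃ v ∈ colSet J n, ∀ j < i, v j = 0) :
    ∃ e, (∃ n ≥ 1, ∃ v ∈ colSet J n, (∀ j < i, v j = 0) ∧ ∀ j k, v j k ≤ e) ∧
      ∀ p ≥ i, ∀ᶠ n in atTop, idealOmega p (J n) = e := by
  classical
  have hex : ∃ e, ∃ n ≥ 1, ∃ v ∈ colSet J n, (∀ j < i, v j = 0) ∧ ∀ j k, v j k ≤ e := by
    obtain ⟨n, hn, v, hv, hvi⟩ := h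
    refine ⟨(ofCols n v).degree, n, hn, toCols (ofCols n v), ?_, fun j hj => ?_, fun j k => ?_⟩
    · rwa [toCols_mem_colSet]
    · funext k
      unfold toCols
      split_ifs with hjn
      · rw [ofCols_apply, hvi j hj]
      · rfl
    · unfold toCols
      split_ifs with hjn
      · exact Finsupp.le_degree _ _
      · exact Nat.zero_le _
  refine ⟨Nat.find hex, Nat.find_spec hex, fun p hp => ?_⟩
  obtain ⟨m, hm, v, hv, hvi, hve⟩ := Nat.find_spec hex
  filter_upwards [eventually_ge_atTop (m + p)] with n hn
  -- The optimal monomial shifted right by `p - i`; the fixed columns `j < i` are zero, so nothing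
  -- is lost.
  let v' : ℕ → Fin c → ℕ := fun j => if j < p then 0 else v (j - (p - i))
  have hv' : v' ∈ colSet J n := by
    refine hJ m n hm (by omega) (fun j => if j < i then j else j + (p - i))
      (fun j l hjl _ => ?_) (fun j hj => ?_) (fun j _ hj => if_pos hj) v hv v' (fun j _ => ?_)
    · split_ifs <;> omega
    · split_ifs <;> omega
    · by_cases hj : j < i
      · rw [hvi j hj]; exact zero_le
      · have h1 : ¬ j + (p - i) < p := by omega
        simp only [v', if_neg hj, if_neg h1, Nat.add_sub_cancel, le_refl]
  obtain ⟨g, hg, hgv⟩ := exists_minGens_le hv'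
  have hgv' : ∀ x : FinVar c n, g x ≤ v' (ofLex x).2 (ofLex x).1 := fun x => hgv x
  have hgplus : g ∈ minGensPlus p (J n) := by
    refine ⟨hg, ?_, fun x hx => ?_⟩
    · rintro rfl
      exact h0 ⟨n, by omega, zero_mem_colSet.2 hg.1⟩
    · by_contra hlt
      have h1 := hgv' x
      rw [Finsupp.mem_support_iff] at hx
      simp only [v', if_pos (not_le.1 hlt), Pi.zero_apply] at h1
      omega
  have hne : (minGensPlus p (J n)).Nonempty := ⟨g, hgplus⟩
  rw [idealOmega, if_pos hne]
  apply le_antisymm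
  · refine (Nat.sInf_le (Set.mem_image_of_mem _ hgplus)).trans ?_
    rw [weight_le_iff]
    intro k
    rw [rowWeight_le_iff]
    intro j hj
    refine (hgv' _).trans ?_
    simp only [v', ofLex_toLex, if_neg hj.not_gt]
    exact hve _ _
  · obtain ⟨u, hu, hueq⟩ := Nat.sInf_mem (hne.image (weight p))
    rw [← hueq]
    apply Nat.find_min'
    have hlow : ∀ (j : ℕ) (k : Fin c), j < p → toCols u j k = 0 := by
      intro j k hj
      unfold toCols
      split_ifs with hjn
      · by_contra hne
        exact absurd (hu.2.2 _ (Finsupp.mem_support_iff.2 hne)) (by simpa using hj)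
      · rfl
    refine ⟨n, by omega, toCols u, toCols_mem_colSet.2 hu.1.1,
      fun j hj => funext fun k => hlow j k (hj.trans_le hp), fun j k => ?_⟩
    rcases lt_or_ge j p with hj | hj
    · rw [hlow j k hj]; exact Nat.zero_le _
    · unfold toCols
      split_ifs with hjn
      · exact (rowWeight_le_iff p k u _).1 ((weight_le_iff p u _).1 le_rfl k) ⟨j, hjn⟩ hj
      · exact Nat.zero_le _

theorem idealOmega_eq_sup_of_not_exists (h : ¬ ∃ n ≥ 1, ∃ v ∈ colSet J n, ∀ j < i, v j = 0)
    {p n : ℕ} (hp : i ≤ p) (hn : 1 ≤ n) :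
    idealOmega p (J n) = Finset.univ.sup fun k => idealRowWeight p k (J n) := by
  have hempty : ¬ (minGensPlus p (J n)).Nonempty := by
    rintro ⟨u, hu⟩
    refine h ⟨n, hn, toCols u, toCols_mem_colSet.2 hu.1.1, fun j hj => funext fun k => ?_⟩
    unfold toCols
    split_ifs with hjn
    · by_contra hne
      exact absurd (hu.2.2 _ (Finsupp.mem_support_iff.2 hne)) (by simpa using hj.trans_le hp)
    · rfl
  rw [idealOmega, if_neg hempty, sSup_weight_minGens]

end Chain

end ColumnsOfIdeals

/-! ### Cone apexes in large degrees -/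

section ConeApex

variable {K : Type*} [Field K] {c : ℕ}

/-- Since `x ∉ A`, the exponent of `x` in `u` is `m x - 1 ≥ t`, so a generator dividing `u + x`
already divides `u`. -/
theorem hasConeApex_of_lt {σ : Type*} [Finite σ] {J : Ideal (MvPolynomial σ K)} {m : σ →₀ ℕ}
    {x : σ} {t : ℕ} (ht : ∀ g ∈ minGens J, g x ≤ t) (hx : t < m x) (p : ℕ) :
    HasConeApex J p m := by
  classical
  refine ⟨x, by omega, fun A _ hxA u hu hmem => ?_⟩
  obtain ⟨g, hg, hgu⟩ := exists_minGens_le hmem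
  refine monomial_mem_of_le hg.1 fun y => ?_
  by_cases hy : y = x
  · subst hy
    have h1 := DFunLike.congr_fun hu y
    rw [Finsupp.add_apply, Finsupp.add_apply, finsetExponent_apply, if_neg hxA,
      Finsupp.single_eq_same] at h1
    have := ht g hg
    omega
  · have h1 := hgu y
    rwa [Finsupp.add_apply, Finsupp.single_eq_of_ne hy, add_zero] at h1

theorem exists_one_le_of_degree_pos {σ : Type*} {m : σ →₀ ℕ} (h : 0 < m.degree) :
    ∃ x, 1 ≤ m x := by
  by_contra hcon
  push Not at hcon
  have : m = 0 := by
    ext x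
    have := hcon x
    simp only [Finsupp.coe_zero, Pi.zero_apply]
    omega
  simp [this] at h

variable {n : ℕ}

theorem degree_eq_sum_toCols (m : FinVar c n →₀ ℕ) :
    m.degree = ∑ j ∈ Finset.range n, ∑ k, toCols m j k := by
  rw [Finsupp.degree_eq_sum, ← (toLex (α := Fin c × Fin n)).sum_comp, Fintype.sum_prod_type,
    Finset.sum_comm, ← Fin.sum_univ_eq_sum_range]
  simp only [toCols_apply]

/-- Removing one variable and a squarefree monomial of degree `p` leaves all but `p + 1` columns
unchanged. -/
theorem exists_unchanged_columns {m u : FinVar c n →₀ ℕ} {x : FinVar c n}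
    {A : Finset (FinVar c n)} (hu : u + Finsupp.single x 1 + finsetExponent A = m)
    (T : Finset ℕ) : ∃ T' ⊆ T, T.card ≤ T'.card + (A.card + 1) ∧
      ∀ j ∈ T', toCols u j = toCols m j := by
  classical
  refine ⟨T \ (insert x A).image fun y => ((ofLex y).2 : ℕ), Finset.sdiff_subset, ?_, ?_⟩
  · have h1 := Finset.le_card_sdiff ((insert x A).image fun y => ((ofLex y).2 : ℕ)) T
    have h2 : ((insert x A).image fun y => ((ofLex y).2 : ℕ)).card ≤ A.card + 1 :=
      Finset.card_image_le.trans (Finset.card_insert_le x A)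
    omega
  · intro j hj
    funext k
    unfold toCols
    split_ifs with hjn
    · have hnot : toLex (k, (⟨j, hjn⟩ : Fin n)) ∉ insert x A := fun hmem =>
        (Finset.mem_sdiff.1 hj).2 (Finset.mem_image.2 ⟨_, hmem, rfl⟩)
      rw [Finset.mem_insert, not_or] at hnot
      rw [← hu, Finsupp.add_apply, Finsupp.add_apply, finsetExponent_apply, if_neg hnot.2,
        Finsupp.single_eq_of_ne hnot.1]
      rfl
    · rfl

/-- Degree count: a generic column contributes at most `C`, the first `P` and those in `T₀` an extra
`B`, those in `T` an extra `1`. The last allowance absorbs the homological degree with slope one. -/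
theorem sum_le_of_exceptional_columns {s : ℕ → ℕ} {C B P : ℕ} (T₀ T : Finset ℕ)
    (h : ∀ j < n, s j ≤ C + (if j < P then B else 0) + (if j ∈ T₀ then B else 0) +
      if j ∈ T then 1 else 0) :
    ∑ j ∈ Finset.range n, s j ≤ C * n + P * B + T₀.card * B + T.card := by
  have hcount : ∀ (S : Finset ℕ) (b : ℕ),
      ∑ j ∈ Finset.range n, (if j ∈ S then b else 0) ≤ S.card * b := by
    intro S b
    rw [← Finset.sum_filter, Finset.sum_const, smul_eq_mul]
    refine Nat.mul_le_mul_right _ (Finset.card_le_card fun j hj => (Finset.mem_filter.1 hj).2)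
  have hP : ∑ j ∈ Finset.range n, (if j < P then B else 0) ≤ P * B := by
    simpa using hcount (Finset.range P) B
  have h0 := hcount T₀ B
  have h1 := hcount T 1
  refine (Finset.sum_le_sum fun j hj => h j (Finset.mem_range.1 hj)).trans ?_
  rw [Finset.sum_add_distrib, Finset.sum_add_distrib, Finset.sum_add_distrib, Finset.sum_const,
    Finset.card_range, smul_eq_mul, mul_comm n C]
  omega

theorem sum_le_add_sup_erase {a w : Fin c → ℕ} (haw : ∀ k, a k ≤ w k) (k₀ : Fin c) :
    ∑ k, a k ≤ a k₀ + Finset.univ.sup fun l : Fin c => ∑ k ∈ Finset.univ.erase l, w k := by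
  rw [← Finset.add_sum_erase _ _ (Finset.mem_univ k₀)]
  refine Nat.add_le_add_left ((Finset.sum_le_sum fun k _ => haw k).trans ?_) _
  exact Finset.le_sup (f := fun l : Fin c => ∑ k ∈ Finset.univ.erase l, w k) (Finset.mem_univ k₀)

variable {i : ℕ} {J : (n : ℕ) → Ideal (MvPolynomial (FinVar c n) K)}

theorem toCols_le_of_not_hasConeApex {P W p : ℕ} {w : Fin c → ℕ}
    {J : Ideal (MvPolynomial (FinVar c n) K)} (hw : ∀ k, idealRowWeight P k J = w k)
    (hW : ∀ g ∈ minGens J, ∀ x, g x ≤ W) {m : FinVar c n →₀ ℕ} (hm : ¬ HasConeApex J p m) :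
    (∀ j k, toCols m j k ≤ W) ∧ ∀ j k, P ≤ j → toCols m j k ≤ w k := by
  constructor
  · intro j k
    unfold toCols
    split_ifs with hj
    · by_contra hlt
      exact hm (hasConeApex_of_lt (fun g hg => hW g hg _) (not_le.1 hlt) p)
    · exact Nat.zero_le _
  · intro j k hPj
    unfold toCols
    split_ifs with hj
    · by_contra hlt
      exact hm (hasConeApex_of_lt (fun g hg => (idealRowWeight_le_iff P k J (w k)).1
        (hw k).le g hg ⟨j, hj⟩ hPj) (not_le.1 hlt) p)
    · exact Nat.zero_le _

theorem eventually_hasConeApex_of_zero_mem (hJ : IsIncClosed i (colSet J))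
    (h : ∃ n ≥ 1, (0 : ℕ → Fin c → ℕ) ∈ colSet J n) :
    ∀ᶠ n in atTop, ∀ (p : ℕ) (m : FinVar c n →₀ ℕ), 0 < m.degree → HasConeApex (J n) p m := by
  obtain ⟨N, hN, h0⟩ := h
  filter_upwards [eventually_ge_atTop N] with n hn p m hm
  obtain ⟨x, hx⟩ := exists_one_le_of_degree_pos hm
  exact ⟨x, hx, fun A _ _ u _ _ => monomial_mem_of_le
    (zero_mem_colSet.1 (hJ.upward hN hn h0 fun _ _ => le_rfl)) zero_le⟩

/-- A single monomial of width `N` with entries at most `ω` and first `i` columns zero fits into any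
`N` columns with all entries at least `ω`. Too many such columns make any variable dividing `x^m` an
apex. -/
theorem exists_eventually_hasConeApex_of_mem (hJ : IsIncClosed i (colSet J)) {P W ω : ℕ}
    (hP : i ≤ P) {w : Fin c → ℕ} (hw : ∀ᶠ n in atTop, ∀ k, idealRowWeight P k (J n) = w k)
    (hW : ∀ᶠ n in atTop, ∀ g ∈ minGens (J n), ∀ x, g x ≤ W)
    (hex : ∃ n ≥ 1, ∃ v ∈ colSet J n, (∀ j < i, v j = 0) ∧ ∀ j k, v j k ≤ ω) :
    ∃ D, ∀ᶠ n in atTop, ∀ (p : ℕ) (m : FinVar c n →₀ ℕ),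
      ((ω - 1) + Finset.univ.sup fun l : Fin c => ∑ k ∈ Finset.univ.erase l, w k) * n + D + p <
        m.degree → HasConeApex (J n) p m := by
  classical
  obtain ⟨N, hN, v, hv, hvi, hvω⟩ := hex
  set s := Finset.univ.sup fun l : Fin c => ∑ k ∈ Finset.univ.erase l, w k with hs
  -- Each of the first `P` columns and of the fewer than `N` columns in `T₀` has sum at most `c *
  -- W`; the set `T` adds at most `N + p`.
  refine ⟨P * (c * W) + N * (c * W) + N + 1, ?_⟩
  filter_upwards [hw, hW, eventually_ge_atTop N] with n hwn hWn hn p m hdeg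
  by_contra hcon
  obtain ⟨hmW, hmw⟩ := toCols_le_of_not_hasConeApex hwn hWn hcon
  obtain ⟨x, hx⟩ := exists_one_le_of_degree_pos (lt_of_le_of_lt (Nat.zero_le _) hdeg)
  let T := (Finset.Ico P n).filter fun j => ∀ k, ω ≤ toCols m j k
  let T₀ := (Finset.Ico P n).filter fun j => ∀ k, ω + 1 ≤ toCols m j k
  have hplace : ∀ (u : FinVar c n →₀ ℕ) (S : Finset ℕ), S ⊆ Finset.Ico P n → N ≤ S.card →
      (∀ j ∈ S, ∀ k, ω ≤ toCols u j k) → monomial u (1 : K) ∈ J n := by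
    intro u S hS hcard hSω
    rw [← toCols_mem_colSet]
    refine hJ.mem_of_card_le le_rfl hN hn hv S (fun l hl => ?_) hcard (fun j hj _ => ?_)
      (fun j _ _ l hl k => (hvω j k).trans (hSω l hl k))
    · have := Finset.mem_Ico.1 (hS hl)
      omega
    · rw [hvi j hj]; exact zero_le
  -- Removing `x` and the squarefree `A` lowers each entry by at most one, as `x ∉ A`; so this bound
  -- is free of `p`.
  have hT₀ : T₀.card < N := by
    by_contra hge
    refine hcon ⟨x, hx, fun A _ hxA u hu _ => hplace u T₀ (Finset.filter_subset _ _)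
      (not_lt.1 hge) fun j hj k => ?_⟩
    obtain ⟨hjI, hjk⟩ := Finset.mem_filter.1 hj
    have hjn := (Finset.mem_Ico.1 hjI).2
    have h1 := hjk k
    have h2 := DFunLike.congr_fun hu (toLex (k, ⟨j, hjn⟩))
    rw [Finsupp.add_apply, Finsupp.add_apply, finsetExponent_apply] at h2
    simp only [toCols, dif_pos hjn] at h1 ⊢
    by_cases hxe : toLex (k, (⟨j, hjn⟩ : Fin n)) = x
    · rw [hxe, if_neg hxA, Finsupp.single_eq_same, ← hxe] at h2
      omega
    · rw [Finsupp.single_eq_of_ne hxe] at h2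
      split_ifs at h2 <;> omega
  -- At most `p + 1` columns are touched, so `N` of these would survive unchanged.
  have hT : T.card < N + p + 1 := by
    by_contra hge
    refine hcon ⟨x, hx, fun A hA hxA u hu _ => ?_⟩
    obtain ⟨T', hT'T, hcard, hT'⟩ := exists_unchanged_columns hu T
    refine hplace u T' (hT'T.trans (Finset.filter_subset _ _)) (by omega) fun j hj k => ?_
    rw [hT' j hj]
    exact (Finset.mem_filter.1 (hT'T hj)).2 k
  have hsum : m.degree ≤ ((ω - 1) + s) * n + P * (c * W) + T₀.card * (c * W) + T.card := by
    rw [degree_eq_sum_toCols]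
    refine sum_le_of_exceptional_columns T₀ T fun j hj => ?_
    have hcW : ∑ k, toCols m j k ≤ c * W := by
      simpa using Finset.sum_le_sum fun k (_ : k ∈ Finset.univ) => hmW j k
    by_cases hjP : j < P
    · rw [if_pos hjP]; omega
    have hjI : j ∈ Finset.Ico P n := Finset.mem_Ico.2 ⟨not_lt.1 hjP, hj⟩
    have hjw : ∀ k, toCols m j k ≤ w k := fun k => hmw j k (not_lt.1 hjP)
    by_cases hj0 : j ∈ T₀
    · rw [if_pos hj0]; omega
    obtain ⟨k₀, hk₀⟩ : ∃ k, toCols m j k ≤ ω := by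
      by_contra hall
      push Not at hall
      exact hj0 (Finset.mem_filter.2 ⟨hjI, hall⟩)
    have h1 := sum_le_add_sup_erase hjw k₀
    by_cases hjT : j ∈ T
    · rw [if_pos hjT]; omega
    obtain ⟨k₁, hk₁⟩ : ∃ k, toCols m j k < ω := by
      by_contra hall
      push Not at hall
      exact hjT (Finset.mem_filter.2 ⟨hjI, hall⟩)
    have h2 := sum_le_add_sup_erase hjw k₁
    omega
  have : T₀.card * (c * W) ≤ N * (c * W) := Nat.mul_le_mul_right _ hT₀.le
  omega

/-- Used when no monomial of the chain avoids the first `i` columns. The apex is taken in a column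
`≥ P`, so dividing by it keeps the first `P` columns; membership in `J n` then depends only on
these, given enough columns dominating `(w_k)`. -/
theorem exists_eventually_hasConeApex_of_sup (hJ : IsIncClosed i (colSet J)) {P W : ℕ}
    (hP : i ≤ P) {w : Fin c → ℕ} (hw : ∀ᶠ n in atTop, ∀ k, idealRowWeight P k (J n) = w k)
    (hW : ∀ᶠ n in atTop, ∀ g ∈ minGens (J n), ∀ x, g x ≤ W) :
    ∃ D, ∀ᶠ n in atTop, ∀ (p : ℕ) (m : FinVar c n →₀ ℕ),
      ((Finset.univ.sup w - 1) +
        Finset.univ.sup fun l : Fin c => ∑ k ∈ Finset.univ.erase l, w k) * n + D + p <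
        m.degree → HasConeApex (J n) p m := by
  classical
  set ω := Finset.univ.sup w with hω
  set s := Finset.univ.sup fun l : Fin c => ∑ k ∈ Finset.univ.erase l, w k with hs
  have hwω : ∀ k, w k ≤ ω := fun k => Finset.le_sup (Finset.mem_univ k)
  -- The apex below needs a row with `w k₀ ≥ 1`. If there is none, the columns of `m` from `P` on
  -- vanish.
  by_cases hω0 : ω = 0
  · refine ⟨P * (c * W), ?_⟩
    filter_upwards [hw, hW] with n hwn hWn p m hdeg
    by_contra hcon
    obtain ⟨hmW, hmw⟩ := toCols_le_of_not_hasConeApex hwn hWn hcon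
    have hsum : m.degree ≤ 0 * n + P * (c * W) + (∅ : Finset ℕ).card * (c * W) +
        (∅ : Finset ℕ).card := by
      rw [degree_eq_sum_toCols]
      refine sum_le_of_exceptional_columns ∅ ∅ fun j hj => ?_
      by_cases hjP : j < P
      · rw [if_pos hjP]
        have hcW : ∑ k, toCols m j k ≤ c * W := by
          simpa using Finset.sum_le_sum fun k (_ : k ∈ Finset.univ) => hmW j k
        omega
      · have hz : ∑ k, toCols m j k = 0 := Finset.sum_eq_zero fun k _ => by
          have h1 := hmw j k (not_lt.1 hjP)
          have h2 := hwω k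
          omega
        rw [hz]
        exact Nat.zero_le _
    simp only [Finset.card_empty, zero_mul] at hsum
    have := Nat.zero_le ((ω - 1 + s) * n)
    omega
  have hne : (Finset.univ : Finset (Fin c)).Nonempty := by
    rw [Finset.nonempty_iff_ne_empty]
    intro hemp
    exact hω0 (by rw [hω, hemp, Finset.sup_empty]; rfl)
  obtain ⟨k₀, -, hk₀⟩ := Finset.exists_mem_eq_sup Finset.univ hne w
  obtain ⟨n₁, hn₁⟩ := eventually_atTop.1 (hw.and (hW.and (eventually_ge_atTop 1)))
  -- There are finitely many bounds `a` on the first `P` columns, so the widths of monomials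
  -- realising them, with later columns below `(w_k)`, have a common bound.
  have hbox : ∀ a : Fin P → Fin c → Fin (W + 1), ∃ N,
      (∃ n ≥ n₁, ∃ v ∈ colSet J n, ∀ (j : Fin P) k, v j k ≤ a j k) →
      ∃ n', 1 ≤ n' ∧ n' ≤ N ∧ ∃ v ∈ colSet J n', (∀ (j : Fin P) k, v j k ≤ a j k) ∧
        ∀ j k, P ≤ j → v j k ≤ w k := by
    intro a
    by_cases h : ∃ n ≥ n₁, ∃ v ∈ colSet J n, ∀ (j : Fin P) k, v j k ≤ a j k
    · obtain ⟨n, hn, v, hv, hva⟩ := h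
      obtain ⟨g, hg, hgv⟩ := exists_minGens_le hv
      refine ⟨n, fun _ => ⟨n, (hn₁ n hn).2.2, le_rfl, toCols g, toCols_mem_colSet.2 hg.1,
        fun j k => ?_, fun j k hPj => ?_⟩⟩
      · unfold toCols
        split_ifs with hjn
        · exact (hgv (toLex (k, ⟨j, hjn⟩))).trans (hva j k)
        · exact Nat.zero_le _
      · unfold toCols
        split_ifs with hjn
        · exact (idealRowWeight_le_iff P k (J n) (w k)).1 ((hn₁ n hn).1 k).le g hg ⟨j, hjn⟩ hPj
        · exact Nat.zero_le _
    · exact ⟨0, fun h' => absurd h' h⟩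
  choose N hN using hbox
  set N₀ := Finset.univ.sup N with hN₀
  refine ⟨P * (c * W) + N₀ + 1, ?_⟩
  filter_upwards [eventually_ge_atTop n₁, eventually_ge_atTop N₀] with n hn hnN p m hdeg
  by_contra hcon
  obtain ⟨hmW, hmw⟩ := toCols_le_of_not_hasConeApex (hn₁ n hn).1 (hn₁ n hn).2.1 hcon
  let T := (Finset.Ico P n).filter fun j => ∀ k, w k ≤ toCols m j k
  have hT : T.card < N₀ + p + 1 := by
    by_contra hge
    obtain ⟨j₀, hj₀⟩ : T.Nonempty := Finset.card_pos.1 (by omega)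
    obtain ⟨hj₀I, hj₀k⟩ := Finset.mem_filter.1 hj₀
    obtain ⟨hPj₀, hj₀n⟩ := Finset.mem_Ico.1 hj₀I
    refine hcon ⟨toLex (k₀, ⟨j₀, hj₀n⟩), ?_, fun A hA hxA u hu hmem => ?_⟩
    · have := hj₀k k₀
      simp only [toCols, dif_pos hj₀n] at this
      omega
    · obtain ⟨T', hT'T, hcard, hT'⟩ := exists_unchanged_columns hu T
      have hum : u ≤ m := by
        rw [← hu, add_assoc]
        exact le_self_add
      have huW : ∀ j k, toCols u j k ≤ W := fun j k => by
        refine le_trans ?_ (hmW j k)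
        unfold toCols
        split_ifs
        · exact hum _
        · exact le_rfl
      have hlow : ∀ (j : Fin P) k,
          toCols (u + Finsupp.single (toLex (k₀, (⟨j₀, hj₀n⟩ : Fin n))) 1) j k =
            toCols u j k := by
        intro j k
        unfold toCols
        split_ifs with hjn
        · rw [Finsupp.add_apply, Finsupp.single_eq_of_ne, add_zero]
          intro heq
          have h3 := congrArg (fun y : FinVar c n => ((ofLex y).2 : ℕ)) heq
          have h4 : (j : ℕ) = j₀ := h3
          have := j.2
          omega
        · rfl
      obtain ⟨n', hn'1, hn'N, v, hv, hva, hvw⟩ :=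
        hN (fun j k => ⟨toCols u j k, Nat.lt_succ_of_le (huW j k)⟩)
          ⟨n, hn, _, toCols_mem_colSet.2 hmem, fun j k => (hlow j k).le⟩
      have hn'N₀ : n' ≤ N₀ := hn'N.trans (Finset.le_sup (f := N) (Finset.mem_univ _))
      rw [← toCols_mem_colSet]
      refine hJ.mem_of_card_le hP hn'1 (hn'N₀.trans hnN) hv T' (fun l hl => ?_) (by omega)
        (fun j hj _ k => hva ⟨j, hj⟩ k) (fun j _ hPj l hl k => (hvw j k hPj).trans ?_)
      · exact Finset.mem_Ico.1 (Finset.mem_filter.1 (hT'T hl)).1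
      · rw [hT' l hl]
        exact (Finset.mem_filter.1 (hT'T hl)).2 k
  have hsw : ∑ k, w k ≤ ω + s := by
    rw [hω, hk₀]
    exact sum_le_add_sup_erase (fun k => le_refl (w k)) k₀
  have hsum : m.degree ≤ ((ω - 1) + s) * n + P * (c * W) + (∅ : Finset ℕ).card * (c * W) +
      T.card := by
    rw [degree_eq_sum_toCols]
    refine sum_le_of_exceptional_columns ∅ T fun j hj => ?_
    by_cases hjP : j < P
    · have hcW : ∑ k, toCols m j k ≤ c * W := by
        simpa using Finset.sum_le_sum fun k (_ : k ∈ Finset.univ) => hmW j k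
      rw [if_pos hjP]; omega
    -- A column outside `T` loses at least one against `∑ k, w k ≤ ω + s`, which gives the summand
    -- `ω - 1`.
    have hjw : ∀ k, toCols m j k ≤ w k := fun k => hmw j k (not_lt.1 hjP)
    have h1 : ∑ k, toCols m j k ≤ ∑ k, w k := Finset.sum_le_sum fun k _ => hjw k
    by_cases hjT : j ∈ T
    · rw [if_pos hjT]; omega
    obtain ⟨k₁, hk₁⟩ : ∃ k, toCols m j k < w k := by
      by_contra hall
      push Not at hall
      exact hjT (Finset.mem_filter.2 ⟨Finset.mem_Ico.2 ⟨not_lt.1 hjP, hj⟩, hall⟩)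
    have h2 : ∑ k, toCols m j k < ∑ k, w k :=
      Finset.sum_lt_sum (fun k _ => hjw k) ⟨k₁, Finset.mem_univ _, hk₁⟩
    omega
  simp only [Finset.card_empty, zero_mul] at hsum
  omega

end ConeApex

end

/-! ### The regularity bound -/

theorem mainTheorem2 {K : Type*} [Field K] (c : ℕ) (hc : 1 ≤ c) (i : ℕ)
    (I : (n : ℕ) → Ideal (MvPolynomial (FinVar c n) K))
    (hgraded : ∀ n, 1 ≤ n → IsGradedIdeal (I n))
    (hinv : IsIncInvariant i I)
    (hnonzero : ∃ n, 1 ≤ n ∧ I n ≠ ⊥)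
    (le : (InfVar c →₀ ℕ) → (InfVar c →₀ ℕ) → Prop)
    (hle : IsMonomialOrder le) (hresp : RespectsInc i le) :
    (∀ᶠ i' in Filter.atTop, ∀ᶠ n in Filter.atTop,
      idealOmega i' (initialChain le I n) = chainOmega (initialChain le I)) ∧
    (∀ k : Fin c, ∀ᶠ i' in Filter.atTop, ∀ᶠ n in Filter.atTop,
      idealRowWeight i' k (initialChain le I n) = chainRowWeight (initialChain le I) k) ∧
    ∃ D : ℤ, ∀ᶠ n : ℕ in Filter.atTop,
      regularity (I n) ≤ (((chainC (initialChain le I) : ℝ) * (n : ℝ) + (D : ℝ) : ℝ) : EReal) := by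
  set J := initialChain le I with hJdef
  have hJ : IsIncClosed i (colSet J) := isIncClosed_initialChain hinv hle hresp
  choose w hw using exists_eventually_eventually_idealRowWeight_eq hJ
  have hweq : ∀ k, chainRowWeight J k = w k := fun k => eventualValue_eventualValue_eq (hw k)
  obtain ⟨W, hW⟩ := exists_bound_minGens hJ
  have hwall : ∀ᶠ p in atTop, ∀ᶠ n in atTop, ∀ k, idealRowWeight p k (J n) = w k := by
    simpa only [eventually_all] using hw
  obtain ⟨P, hPw, hPi⟩ := (hwall.and (eventually_ge_atTop i)).exists
  -- Three cases: `1` occurs in the chain; otherwise some monomial avoids the first `i` columns; or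
  -- none does, and `ω` is the maximum of the `w_k`.
  obtain ⟨ω, hω, D, hD⟩ : ∃ ω, (∀ᶠ p in atTop, ∀ᶠ n in atTop, idealOmega p (J n) = ω) ∧
      ∃ D, ∀ᶠ n in atTop, ∀ (p : ℕ) (m : FinVar c n →₀ ℕ),
        ((ω - 1) + Finset.univ.sup fun l : Fin c => ∑ k ∈ Finset.univ.erase l, w k) * n + D + p <
          m.degree → HasConeApex (J n) p m := by
    by_cases h0 : ∃ n ≥ 1, (0 : ℕ → Fin c → ℕ) ∈ colSet J n
    · refine ⟨0, Eventually.of_forall (eventually_idealOmega_of_zero_mem hJ h0), 0, ?_⟩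
      filter_upwards [eventually_hasConeApex_of_zero_mem hJ h0] with n hn p m hm
      exact hn p m (lt_of_le_of_lt (Nat.zero_le _) hm)
    by_cases h1 : ∃ n ≥ 1, ∃ v ∈ colSet J n, ∀ j < i, v j = 0
    · obtain ⟨e, he, hev⟩ := eventually_idealOmega_of_exists hJ h0 h1
      exact ⟨e, eventually_atTop.2 ⟨i, hev⟩, exists_eventually_hasConeApex_of_mem hJ hPi hPw hW he⟩
    · refine ⟨Finset.univ.sup w, ?_, exists_eventually_hasConeApex_of_sup hJ hPi hPw hW⟩
      filter_upwards [hwall, eventually_ge_atTop i] with p hp hpi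
      filter_upwards [hp, eventually_ge_atTop 1] with n hn hn1
      rw [idealOmega_eq_sup_of_not_exists h1 hpi hn1]
      simp only [hn]
  have hωeq : chainOmega J = ω := eventualValue_eventualValue_eq hω
  refine ⟨by rwa [hωeq], fun k => by rw [hweq]; exact hw k, (D : ℤ), ?_⟩
  have hC : chainC J =
      (ω - 1) + Finset.univ.sup fun l : Fin c => ∑ k ∈ Finset.univ.erase l, w k := by
    simp only [chainC, hωeq, hweq]
  rw [← hC] at hD
  filter_upwards [hD, eventually_ge_atTop 1] with n hn hn1
  refine sSup_le ?_
  rintro _ ⟨p, q, hTor, rfl⟩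
  rw [EReal.coe_le_coe_iff]
  by_contra hlt
  push Not at hlt
  have hnat : chainC J * n + D + p < q := by
    have h2 : (chainC J : ℝ) * n + D + p < q := by
      push_cast at hlt
      linarith
    exact_mod_cast h2
  refine not_nontrivial_gradedTor (koszulCycles_le_koszulBoundaries
    (isMonomialOrder_restrictOrder hle n) (hgraded n hn1) p q fun m hm => ?_) hTor
  exact hn p m (by omega)
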